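/- **Setting.** The domains are $\mathsf{public}\sqsubseteq\mathsf{verifier}\sqsubseteq\mathsf{prover}$, the stages $\mathsf{post}\sqsubseteq\mathsf{pre}$. Data types are $\mathsf{uint}$, $\mathsf{bool}$ (unbounded, only in stage $\mathsf{pre}$), $\mathsf{uint}[N]$, $\mathsf{bool}[N]$ ($N\ge 1$), the unit type $()$, and $\mathsf{list}[q]$, where $q=(t\,s\,d)$ is a qualified type (data type, stage, domain). Put $\langle d\rangle=\{d' : d\sqsubseteq d'\}$, $\langle\mathsf{pre}\rangle=\varnothing$, $\langle\mathsf{post}\rangle=\langle\mathsf{public}\rangle$, $\langle \mathsf{list}[t\,s\,d]\rangle=\langle t\rangle\cup\langle s\rangle\cup\langle d\rangle$, and $\langle t\rangle=\varnothing$ for other $t$. A qualified type $(t\,s\,d)$ is *well-structured* if $t$ is not a list type, and $s=\mathsf{pre}$ when $t=()$; or $t=\mathsf{list}[t'\,s'\,d']$ with $s=\mathsf{pre}$, $\langle s'\rangle\cup\langle d'\rangle\subseteq\langle d\rangle$ and $(t'\,s'\,d')$ well-structured. A type environment $\Gamma$ is a finite association list of items $x:q$ and $\mathsf{mut}\,x:b$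 with $b\in\{0,1\}$ (lookup takes the first match); it is well-structured if all its types are. **Typing** $\Gamma\vdash e:q\,!\,D$, where $D$ is a set of domains (the effect). Write $*$ for $()\,\mathsf{pre}\,\mathsf{public}$; an omitted modulus is allowed in stage $\mathsf{pre}$. - $\epsilon: *\,!\,\varnothing$; literals $n:\mathsf{uint}[N]\,s\,d\,!\,\langle s\rangle$ and $b:\mathsf{bool}[N]\,s\,d\,!\,\langle s\rangle$ for any $s,d$; $x:\Gamma(x)\,!\,\varnothing$. - $e_1+e_2:q\,!\,\langle s\rangle\cup D_1\cup D_2$ if both $e_i:q\,!\,D_i$, $q=\mathsf{uint}[N]\,s\,d$. - $\mathsf{assert}(e): *\,!\,\langle\mathsf{public}\rangle$ if $e:\mathsf{bool}[N]\,\mathsf{post}\,d$. - $(\mathsf{get}_{d}(k):q):q\,!\,\varnothing$ if all stages and domains in $q$, also inside list types, are $\mathsf{pre}$ and $d$. - $\mathsf{if}\ e_1\,\{e_2\}\ \mathsf{else}\,\{e_3\}:t\,s\,d\,!\,D_1\cup D_2\cup D_3$ if $e_1:\mathsf{bool}[N]\,\mathsf{pre}\,d'\,!\,D_1$, $e_i:t\,s\,d\,!\,D_i$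 ($i=2,3$), $\langle d'\rangle\supseteq\langle s\rangle\cup\langle d\rangle\cup D_2\cup D_3$. - $\mathsf{for}\ x\ \mathsf{in}\ e_1..e_2\,\{e_3\}:\mathsf{list}[t\,s\,d]\,\mathsf{pre}\,d'\,!\,D_1\cup D_2\cup D_3$ if $e_1,e_2:\mathsf{uint}\,\mathsf{pre}\,d'$ with effects $D_1,D_2$, $(x:\mathsf{uint}\,\mathsf{pre}\,d'),\Gamma\vdash e_3:t\,s\,d\,!\,D_3$, $\langle d'\rangle\supseteq\langle s\rangle\cup\langle d\rangle\cup D_3$. - $\mathsf{wire}\{e\}:t\,\mathsf{post}\,d\,!\,\langle\mathsf{public}\rangle$ if $e:t\,\mathsf{pre}\,d$, $t\in\{\mathsf{uint}[N],\mathsf{bool}[N]\}$. - $(e\ \mathsf{as}\ t\,s'\,d'):t\,s'\,d'\,!\,D$ if $e:t\,s\,d\,!\,D$, $s\sqsubseteq s'$, $d\sqsubseteq d'$, $\langle d'\rangle\supseteq\langle t\rangle$. - $(l=e): *\,!\,\langle s\rangle\cup\langle d\rangle\cup D\cup D'$ if $e:t\,s\,d\,!\,D$, $l:t\,s\,d\,!\,D'$,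 $l=x[y_1]\dots[y_n]$ and $\Gamma(\mathsf{mut}\,x)=1$. - $l[e]:q\,!\,D\cup D'$ if $l=x[y_1]\dots[y_n]$, $l:\mathsf{list}[q]\,s'\,d'\,!\,D'$, $e:\mathsf{uint}\,s'\,d'\,!\,D$. - $(\mathsf{let}\ \mathsf{mut}^b x=e_1;e_2):q_2\,!\,\langle d_1\rangle\cup D_1\cup D_2$ if $e_1:q_1\,!\,D_1$ with $q_1=t_1\,s_1\,d_1$ and $(\mathsf{mut}\,x:b),(x:q_1),\Gamma\vdash e_2:q_2\,!\,D_2$. $(e_1;e_2):q_2\,!\,D_1\cup D_2$ if $e_i:q_i\,!\,D_i$. The types that these rules give to literals, summands and arguments of $\mathsf{wire}$ are taken as part of the expression. **Circuit semantics.** A monadic value is $\top$ (unknown) or pure: a natural number, a Boolean $\mathbf{tt},\mathbf{ff}$, the unit value, or a finite list of monadic values. A value environment is a stack of pairs (variable, monadic value); lookup and update act on the first pair for a variable. An input dictionary triple $\phi$ gives for each domain $d$ and key $k$ a value $\phi_d(k)$ without $\top$. Streams $\omega=(\omega_{\mathsf{prover}},\omega_{\mathsf{verifier}})$ are two finite lists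 of monadic values. $[\![e]\!]\gamma\phi\omega$ fails or returns (value, environment, streams). It evaluates subexpressions from left to right, threads environment and streams, and fails if a part that is evaluated fails or is undefined (e.g. an index out of bounds). A literal has its value if $s=\mathsf{post}$ or $d=\mathsf{public}$, else $\top$. $x$ is looked up. $+$ adds (modulo $N$ for $\mathsf{uint}[N]$). $\mathsf{assert}$ fails iff its argument fails or is $\mathbf{ff}$. $\mathsf{get}_d(k)$ gives $\phi_d(k)$ if $d=\mathsf{public}$, else $\top$. $\mathsf{if}$ runs the branch chosen by a Boolean guard; otherwise it gives $\top$. $\mathsf{for}$ with bounds $i_1,i_2$ pushes $x$, runs $e_3$ for $x=i_1,\dots,i_2-1$ (setting $x$ before each run), pops $x$ and returns the list of results; it gives $\top$ if a bound is $\top$. $\mathsf{wire}\{e\}$ with $e$ in domain $d$ evaluates $e$, and gives its value if $d=\mathsf{public}$; otherwise it removes and returns the head of $\omega_d$, failing if that is empty. A cast to $t\,s\,d$ keeps the value if $s=\mathsf{post}$ or $d=\mathsf{public}$, else gives $\top$. $x[y_1]\dots[y_n]=e$ reads $x$, evaluates $y_1,\dots,y_n,e$, then sets $x$ to the value read, updated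 at these indices. $\mathsf{let}$ pushes $x$ and pops it afterwards. Operations on $\top$ (addition, indexing, updating in or at $\top$) give $\top$. **Compilation.** Circuits are built from constants $\mathrm{con}(n)$, operations (addition, multiplication modulo $N$) and input nodes $\mathrm{in}_d(k)$, $d\in\{\mathsf{prover},\mathsf{verifier}\}$. For a circuit input $\pi\in(\mathbb N^*)^2$, $c(\pi)$ is the value of $c$ with $\mathrm{in}_d(k)$ read as the entry of $\pi_d$ with index $k$ (from 0); it is undefined if an entry is missing. $|c|$ is the value of $c$ if $c$ has no input nodes, and $\top$ otherwise. Output circuits $o$ *accept* $\pi$ if $c(\pi)=0$ for every $c$ in $o$. Put $|\mathbf{tt}|=0$, $|\mathbf{ff}|=1$. A composite value is a pair $(\hat v,\hat c)$, where $\hat c$ is a circuit or $\top$ and $\hat v$ is $\top$, a number, a Boolean, unit, or a list of composite values. $[\![e]\!]_{\mathrm C}\gamma\phi\nu$, with $\nu\in\mathbb N^2$ the numbers of input nodes created so far, fails or returns (composite value, environment, list of output circuits, counters). It follows the circuit semantics, with output circuits concatenated, and with these clauses for composite values: a literal of value $u$ has $\hat v=u$ if $d=\mathsf{public}$ (else $\top$),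 $\hat c=\mathrm{con}(u)$ (resp. $\mathrm{con}(|u|)$) if $s=\mathsf{post}$ (else $\top$); $+$ adds values and makes an addition node of the circuits, each $\top$ if an argument is; $\mathsf{assert}$ appends the circuit of its argument to the output (failing if there is none); public $\mathsf{get}$ and $\epsilon$, loop variables, lists and updated lists have no circuit, nonpublic $\mathsf{get}$, unknown guards or bounds and lookups in or at $\top$ give $(\top,\top)$; a cast keeps $\hat v$ iff the target domain is $\mathsf{public}$ and $\hat c$ iff the target stage is $\mathsf{post}$, else puts $\top$; $\mathsf{wire}\{e\}$ with $e$ in domain $d$ keeps $\hat v$, and its circuit is $\mathrm{con}(n)$ or $\mathrm{con}(|b|)$ if $\hat v$ is $n\in\mathbb N$ or a Boolean $b$, and $\mathrm{in}_d(\nu_d)$ if $\hat v=\top$; if $d\neq\mathsf{public}$ then $\nu_d$ increases by 1. **Exactness.** For a primitive $t$, "$v\in t$" means that $v$ is a natural number, a Boolean, or unit, according to $t$. For a predicate $P$ on qualified types, $\hat v$ is *$(t\,s\,d)$-exact in $P$* if $P(t\,s\,d)$ is false and $\hat v=\top$, or $P(t\,s\,d)$ is true and either $t$ is primitive and $\hat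 v\in t$, or $t=\mathsf{list}[q']$ and $\hat v$ is a list of values $q'$-exact in $P$. *In circuit*: $P$ is "$s=\mathsf{post}$ or $d=\mathsf{public}$"; *in domain $d'$*: $P$ is "$d\sqsubseteq d'$". A composite $(\hat v,\hat c)$ is *$(t\,s\,d)$-exact* if: for $s=\mathsf{post}$, $\hat c$ is a circuit $c$, and $\hat v=n\in\mathbb N$ (resp. a Boolean $b$) implies $|c|=n$ (resp. $|b|$) and $|c|=c(\pi)$ for all $\pi$; for $s=\mathsf{pre}$, $\hat c=\top$; for $d=\mathsf{public}$, $\hat v\in t$ if $t$ is primitive, and $\hat v$ is a list of $q'$-exact pairs if $t=\mathsf{list}[q']$; for $d\ne\mathsf{public}$, $\hat v=\top$. An environment is *$\Gamma$-exact* (in circuit) if its variables are those of the typings in $\Gamma$, in order, and each value is exact (in circuit) for the corresponding type. **Correspondence.** $(\hat v,\hat c)\bullet\pi$ is $n$, $|b|$, unit, or the list of all $(\hat v_i,\hat c_i)\bullet\pi$, if $\hat v$ is $n\in\mathbb N$, a Boolean $b$, unit, or the list of the $(\hat v_i,\hat c_i)$; it is $c(\pi)$ if $\hat v=\top$, $\hat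 c=c$, and $\top$ if $\hat v=\hat c=\top$. On environments $\bullet\pi$ acts pointwise; $(\nu\bullet\pi)_d$ is $\pi_d$ without its first $\nu_d$ entries. The relation $\sim$ on monadic values is the least reflexive relation with $b\sim|b|$, $|b|\sim b$ for Booleans $b$ that is compatible with lists of equal length. For environments, $\gamma\sim\gamma'$ means that they have the same variables in order and $\gamma(x)\sim\gamma'(x)$ for each of them; for streams, $\sim$ is entrywise with equal lengths. An assertion with $\bullet\pi$ includes that $\bullet\pi$ is defined. **Theorem.** Let $\Gamma\vdash e:t\,s\,d\,!\,D$ with $\Gamma$ well-structured. Let the composite environment $\gamma$ be $\Gamma$-exact, let $\phi$ be type correct (for each subexpression $\mathsf{get}_{d_0}(k):q_0$ of $e$, $\phi_{d_0}(k)$ is $q_0$-exact in $d_0$), let $\nu\in\mathbb N^2$, and let $[\![e]\!]_{\mathrm C}\gamma\phi\nu=((\hat v,\hat c),\tilde\gamma,\tilde o,\tilde\nu)$. Let $\pi\in(\mathbb N^*)^2$, let $\gamma'$ be a value environment that is $\Gamma$-exact in circuit with $\gamma\bullet\pi\sim\gamma'$, and let $\omega'$ be streams with $\nu\bullet\pi\sim\omega'$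 that are type correct: whenever an input node $\mathrm{in}_{d_0}(k)$ has been created in the compilation by a $\mathsf{wire}$ expression of data type $t_0$, the entry of $\omega'_{d_0}$ with index $k-\nu_{d_0}$ (from 0), if it exists, belongs to $t_0$. Then: 1. If $[\![e]\!]\gamma'\phi\omega'=(\hat v',\tilde\gamma',\tilde\omega')$, then $\tilde o$ accepts $\pi$; moreover $\tilde\gamma\bullet\pi\sim\tilde\gamma'$ and $\tilde\nu\bullet\pi\sim\tilde\omega'$, and if $d=\mathsf{public}$ or $s=\mathsf{post}$ then $(\hat v,\hat c)\bullet\pi\sim\hat v'$. 2. If $[\![e]\!]\gamma'\phi\omega'$ fails, while every input node created in the compilation has an entry in $\pi$, then $\tilde o$ does not accept $\pi$. -/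

import Mathlib

namespace ZKSC

/-! ## Types and expressions -/

/-- Variables. -/
abbrev Var := String

/-- Keys of the input dictionaries. -/
abbrev Key := String

/-- Domains, in the order of growing privacy `pub ≤ verifier ≤ prover`. -/
inductive Domain
  | pub
  | verifier
  | prover
  deriving DecidableEq

def Domain.rank : Domain → ℕ
  | .pub => 0
  | .verifier => 1
  | .prover => 2

instance : LE Domain := ⟨fun d d' => d.rank ≤ d'.rank⟩

/-- The two parties that deliver values to the circuit (the non-public domains). -/
inductive Party
  | verifier
  | prover
  deriving DecidableEq

/-- The party of a non-public domain; the public domain has none. -/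
def Domain.party : Domain → Option Party
  | .pub => none
  | .verifier => some .verifier
  | .prover => some .prover

/-- Stages, ordered by `post ≤ pre`. -/
inductive Stage
  | post
  | pre
  deriving DecidableEq

def Stage.rank : Stage → ℕ
  | .post => 0
  | .pre => 1

instance : LE Stage := ⟨fun s s' => s.rank ≤ s'.rank⟩

/-- Data types. `uint none`, `bool none` are the types of unbounded integers and of local booleans;
`uint (some N)`, `bool (some N)` are the types `uint[N]`, `bool[N]`.
`list t s d` is the type of lists whose elements have the qualified type `t s d`. -/
inductive DataType
  | uint (m : Option ℕ+)
  | bool (m : Option ℕ+)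
  | unit
  | list (t : DataType) (s : Stage) (d : Domain)

/-- Qualified types. -/
structure QType where
  data : DataType
  stage : Stage
  dom : Domain

/-- Expressions. Where the semantics of an expression depends on the type of a part of it, that type
is written in the expression: literals carry their modulus, stage and domain, an addition carries
the modulus of its operands, `wire t d e` carries the data type and the domain of `e`.
`eps` is the missing expression, `letIn b x e₁ e₂` is `let mutᵇ x = e₁; e₂`,
`loop x e₁ e₂ e₃` is `for x in e₁ .. e₂ { e₃ }`, and `load l e` is `l[e]`. -/
inductive Expr
  | eps
  | natLit (n : ℕ) (m : Option ℕ+) (s : Stage) (d : Domain)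
  | boolLit (b : Bool) (m : Option ℕ+) (s : Stage) (d : Domain)
  | var (x : Var)
  | add (m : Option ℕ+) (e₁ e₂ : Expr)
  | assertion (e : Expr)
  | get (d : Domain) (k : Key) (q : QType)
  | cond (e₁ e₂ e₃ : Expr)
  | loop (x : Var) (e₁ e₂ e₃ : Expr)
  | wire (t : DataType) (d : Domain) (e : Expr)
  | cast (e : Expr) (q : QType)
  | assign (l e : Expr)
  | load (l e : Expr)
  | letIn (b : Bool) (x : Var) (e₁ e₂ : Expr)
  | seq (e₁ e₂ : Expr)

/-- `l.root = some x` iff `l` is an L-value `x[y₁]…[yₙ]` over the variable `x`. -/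
def Expr.root : Expr → Option Var
  | .var x => some x
  | .load l _ => l.root
  | _ => none

/-- The subexpressions of the form `get_d(k) : q`. -/
def Expr.gets : Expr → List (Domain × Key × QType)
  | .eps => []
  | .natLit _ _ _ _ => []
  | .boolLit _ _ _ _ => []
  | .var _ => []
  | .add _ e₁ e₂ => e₁.gets ++ e₂.gets
  | .assertion e => e.gets
  | .get d k q => [(d, k, q)]
  | .cond e₁ e₂ e₃ => e₁.gets ++ e₂.gets ++ e₃.gets
  | .loop _ e₁ e₂ e₃ => e₁.gets ++ e₂.gets ++ e₃.gets
  | .wire _ _ e => e.gets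
  | .cast e _ => e.gets
  | .assign l e => l.gets ++ e.gets
  | .load l e => l.gets ++ e.gets
  | .letIn _ _ e₁ e₂ => e₁.gets ++ e₂.gets
  | .seq e₁ e₂ => e₁.gets ++ e₂.gets

/-! ## Static semantics -/

/-- The components of a type environment: `x : q` and `mut x : b`. -/
inductive TyEntry
  | typing (x : Var) (q : QType)
  | mutability (x : Var) (b : Bool)

abbrev TyEnv := List TyEntry

/-- `Γ(x)`. -/
def TyEnv.lookupType : TyEnv → Var → Option QType
  | [], _ => none
  | .typing y q :: Γ, x => if y = x then some q else lookupType Γ x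
  | .mutability _ _ :: Γ, x => lookupType Γ x

/-- `Γ(mut x)`. -/
def TyEnv.lookupMut : TyEnv → Var → Option Bool
  | [], _ => none
  | .typing _ _ :: Γ, x => lookupMut Γ x
  | .mutability y b :: Γ, x => if y = x then some b else lookupMut Γ x

/-- The associations of variables to qualified types, in order. -/
def TyEnv.typings : TyEnv → List (Var × QType)
  | [] => []
  | .typing x q :: Γ => (x, q) :: typings Γ
  | .mutability _ _ :: Γ => typings Γ

/-- `⟨d⟩`: the domain `d` and all larger domains. -/
def Domain.up (d : Domain) : Set Domain := {d' | d ≤ d'}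

/-- `⟨s⟩`. -/
def Stage.up : Stage → Set Domain
  | .pre => ∅
  | .post => Domain.up .pub

/-- `⟨t⟩`. -/
def DataType.up : DataType → Set Domain
  | .list t s d => t.up ∪ s.up ∪ d.up
  | _ => ∅

/-- `allpre_d'(t s d)`. -/
def allPre (d' : Domain) : DataType → Stage → Domain → Prop
  | .list t₁ s₁ d₁, s, d => s = .pre ∧ d = d' ∧ allPre d' t₁ s₁ d₁
  | _, s, d => s = .pre ∧ d = d'

/-- The typing judgement `Γ ⊢ e : q ! D`. Unbounded integers and booleans without modulus are
available in the stage `pre` only. -/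
inductive HasType : TyEnv → Expr → QType → Set Domain → Prop
  | eps {Γ} : HasType Γ .eps ⟨.unit, .pre, .pub⟩ ∅
  | natLit {Γ n m s d} (hm : m = none → s = .pre) :
      HasType Γ (.natLit n m s d) ⟨.uint m, s, d⟩ s.up
  | boolLit {Γ b m s d} (hm : m = none → s = .pre) :
      HasType Γ (.boolLit b m s d) ⟨.bool m, s, d⟩ s.up
  | var {Γ x q} (h : TyEnv.lookupType Γ x = some q) : HasType Γ (.var x) q ∅
  | add {Γ e₁ e₂ m s d D₁ D₂} (hm : m = none → s = .pre)
      (h₁ : HasType Γ e₁ ⟨.uint m, s, d⟩ D₁) (h₂ : HasType Γ e₂ ⟨.uint m, s, d⟩ D₂) :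
      HasType Γ (.add m e₁ e₂) ⟨.uint m, s, d⟩ (s.up ∪ D₁ ∪ D₂)
  | assertion {Γ e N d D} (h : HasType Γ e ⟨.bool (some N), .post, d⟩ D) :
      HasType Γ (.assertion e) ⟨.unit, .pre, .pub⟩ (Domain.up .pub)
  | get {Γ d' k t s d} (h : allPre d' t s d) :
      HasType Γ (.get d' k ⟨t, s, d⟩) ⟨t, s, d⟩ ∅
  | cond {Γ e₁ e₂ e₃ m d' t s d D₁ D₂ D₃}
      (h₁ : HasType Γ e₁ ⟨.bool m, .pre, d'⟩ D₁)
      (h₂ : HasType Γ e₂ ⟨t, s, d⟩ D₂) (h₃ : HasType Γ e₃ ⟨t, s, d⟩ D₃)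
      (hd : s.up ∪ d.up ∪ D₂ ∪ D₃ ⊆ d'.up) :
      HasType Γ (.cond e₁ e₂ e₃) ⟨t, s, d⟩ (D₁ ∪ D₂ ∪ D₃)
  | loop {Γ x e₁ e₂ e₃ d' t s d D₁ D₂ D₃}
      (h₁ : HasType Γ e₁ ⟨.uint none, .pre, d'⟩ D₁)
      (h₂ : HasType Γ e₂ ⟨.uint none, .pre, d'⟩ D₂)
      (h₃ : HasType (.typing x ⟨.uint none, .pre, d'⟩ :: Γ) e₃ ⟨t, s, d⟩ D₃)
      (hd : s.up ∪ d.up ∪ D₃ ⊆ d'.up) :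
      HasType Γ (.loop x e₁ e₂ e₃) ⟨.list t s d, .pre, d'⟩ (D₁ ∪ D₂ ∪ D₃)
  | wire {Γ e N t d D} (ht : t = .uint (some N) ∨ t = .bool (some N))
      (h : HasType Γ e ⟨t, .pre, d⟩ D) :
      HasType Γ (.wire t d e) ⟨t, .post, d⟩ (Domain.up .pub)
  | cast {Γ e t s d s' d' D} (h : HasType Γ e ⟨t, s, d⟩ D)
      (hs : s ≤ s') (hd : d ≤ d') (ht : t.up ⊆ d'.up) :
      HasType Γ (.cast e ⟨t, s', d'⟩) ⟨t, s', d'⟩ D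
  | assign {Γ l e x t s d D D'} (h : HasType Γ e ⟨t, s, d⟩ D) (hl : HasType Γ l ⟨t, s, d⟩ D')
      (hx : l.root = some x) (hm : TyEnv.lookupMut Γ x = some true) :
      HasType Γ (.assign l e) ⟨.unit, .pre, .pub⟩ (s.up ∪ d.up ∪ D ∪ D')
  | load {Γ l e x t s d s' d' D D'} (hx : l.root = some x)
      (hl : HasType Γ l ⟨.list t s d, s', d'⟩ D') (h : HasType Γ e ⟨.uint none, s', d'⟩ D) :
      HasType Γ (.load l e) ⟨t, s, d⟩ (D ∪ D')
  | letIn {Γ b x e₁ e₂ t₁ s₁ d₁ t₂ s₂ d₂ D₁ D₂} (h₁ : HasType Γ e₁ ⟨t₁, s₁, d₁⟩ D₁)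
      (h₂ : HasType (.mutability x b :: .typing x ⟨t₁, s₁, d₁⟩ :: Γ) e₂ ⟨t₂, s₂, d₂⟩ D₂) :
      HasType Γ (.letIn b x e₁ e₂) ⟨t₂, s₂, d₂⟩ (d₁.up ∪ D₁ ∪ D₂)
  | seq {Γ e₁ e₂ q₁ q₂ D₁ D₂} (h₁ : HasType Γ e₁ q₁ D₁) (h₂ : HasType Γ e₂ q₂ D₂) :
      HasType Γ (.seq e₁ e₂) q₂ (D₁ ∪ D₂)

/-- Well-structured qualified types. -/
def WellStructured : DataType → Stage → Domain → Prop
  | .uint _, _, _ => True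
  | .bool _, _, _ => True
  | .unit, s, _ => s = .pre
  | .list t' s' d', s, d => s = .pre ∧ s'.up ∪ d'.up ⊆ d.up ∧ WellStructured t' s' d'

/-- Well-structured type environments. -/
def TyEnv.WellStructured (Γ : TyEnv) : Prop :=
  ∀ a ∈ Γ.typings, ZKSC.WellStructured a.2.data a.2.stage a.2.dom

/-! ## Values and environments -/

/-- The set `U` of core values. -/
inductive Core
  | nat (n : ℕ)
  | bool (b : Bool)
  | unit
  | list (l : List Core)

/-- The set `M V` of monadic values: `top` is the unknown value, the other constructors are the pure
values (`pure n`, `pure b`, the pure unit value, and pure finite sequences of monadic values). -/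
inductive MVal
  | top
  | nat (n : ℕ)
  | bool (b : Bool)
  | unit
  | list (l : List MVal)

/-- Association lists, used as stacks. -/
abbrev Assoc (α : Type) := List (Var × α)

/-- `γ(x)`: the value in the first association of `x`. -/
def Assoc.find {α : Type} : Assoc α → Var → Option α
  | [], _ => none
  | (y, a) :: γ, x => if y = x then some a else find γ x

/-- `[x ↦ a]γ`: the first association of `x` is updated. -/
def Assoc.update {α : Type} : Assoc α → Var → α → Assoc α
  | [], _, _ => []
  | (y, b) :: γ, x, a => if y = x then (y, a) :: γ else (y, b) :: update γ x a

/-- Value environments. -/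
abbrev Env := Assoc MVal

/-- Triples of input dictionaries. -/
abbrev Inputs := Domain → Key → Core

/-- Pairs of streams of values delivered to the circuit. -/
abbrev Streams := Party → List MVal

mutual
/-- `allpure`. -/
def Core.allPure : Core → MVal
  | .nat n => .nat n
  | .bool b => .bool b
  | .unit => .unit
  | .list l => .list (Core.allPureList l)
def Core.allPureList : List Core → List MVal
  | [] => []
  | u :: l => u.allPure :: Core.allPureList l
end

/-- The integer `|b|` that represents the Boolean `b` in the circuit: `|tt| = 0`, `|ff| = 1`. -/
def code (b : Bool) : ℕ := if b then 0 else 1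

/-- Reduction modulo `N`, if there is a modulus. -/
def reduce : Option ℕ+ → ℕ → ℕ
  | none, n => n
  | some N, n => n % (N : ℕ)

/-- `do {i₁ ← v₁; i₂ ← v₂; pure (i₁ + i₂)}`; `none` means that the sum is not defined. -/
def MVal.add (m : Option ℕ+) : MVal → MVal → Option MVal
  | .top, _ => some .top
  | _, .top => some .top
  | .nat i₁, .nat i₂ => some (.nat (reduce m (i₁ + i₂)))
  | _, _ => none

/-- `do {a ← v; i ← w; aᵢ}`; `none` means that the lookup is not defined. -/
def MVal.index : MVal → MVal → Option MVal
  | .top, _ => some .top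
  | _, .top => some .top
  | .list l, .nat i => l[i]?
  | _, _ => none

/-- `upd`; `none` means that the update is not defined (index out of bounds). -/
def MVal.upd : MVal → List MVal → MVal → Option MVal
  | _, [], v => some v
  | .top, _ :: _, _ => some .top
  | _, .top :: _, _ => some .top
  | .list l, .nat i :: is, v => do
      let a ← l[i]?
      let a' ← MVal.upd a is v
      some (.list (l.set i a'))
  | _, _ :: _, _ => none

/-! ## Circuit semantics -/

/-- The iterations of a `for` loop in the circuit semantics: `n` runs of the body, the loop
variable `x` being set to `i`, `i + 1`, … -/
def circuitLoop (body : Env → Streams → Option (MVal × Env × Streams)) (x : Var) :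
    ℕ → ℕ → Env → Streams → Option (List MVal × Env × Streams)
  | 0, _, γ, ω => some ([], γ, ω)
  | n + 1, i, γ, ω => do
      let (a, γ₁, ω₁) ← body (Assoc.update γ x (.nat i)) ω
      let (as, γ₂, ω₂) ← circuitLoop body x n (i + 1) γ₁ ω₁
      some (a :: as, γ₂, ω₂)

mutual
/-- The circuit semantics `⟦e⟧ γ φ ω`; `none` means failure. -/
def circuitSem (φ : Inputs) : Expr → Env → Streams → Option (MVal × Env × Streams)
  | .eps, γ, ω => some (.unit, γ, ω)
  | .natLit n _ s d, γ, ω =>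
      some (if s = .post ∨ d = .pub then .nat n else .top, γ, ω)
  | .boolLit b _ s d, γ, ω =>
      some (if s = .post ∨ d = .pub then .bool b else .top, γ, ω)
  | .var x, γ, ω => do
      let v ← Assoc.find γ x
      some (v, γ, ω)
  | .add m e₁ e₂, γ₀, ω₀ => do
      let (v₁, γ₁, ω₁) ← circuitSem φ e₁ γ₀ ω₀
      let (v₂, γ₂, ω₂) ← circuitSem φ e₂ γ₁ ω₁
      let v ← MVal.add m v₁ v₂
      some (v, γ₂, ω₂)
  | .assertion e, γ₀, ω₀ => do
      let (v, γ₁, ω₁) ← circuitSem φ e γ₀ ω₀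
      match v with
      | .bool false => none
      | _ => some (.unit, γ₁, ω₁)
  | .get d k _, γ, ω =>
      some (if d = .pub then (φ d k).allPure else .top, γ, ω)
  | .cond e₁ e₂ e₃, γ₀, ω₀ => do
      let (v₁, γ₁, ω₁) ← circuitSem φ e₁ γ₀ ω₀
      match v₁ with
      | .bool true => circuitSem φ e₂ γ₁ ω₁
      | .bool false => circuitSem φ e₃ γ₁ ω₁
      | _ => some (.top, γ₁, ω₁)
  | .loop x e₁ e₂ e₃, γ₀, ω₀ => do
      let (v₁, γ₁, ω₁) ← circuitSem φ e₁ γ₀ ω₀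
      let (v₂, γ₂, ω₂) ← circuitSem φ e₂ γ₁ ω₁
      match v₁, v₂ with
      | .nat i₁, .nat i₂ => do
          let (as, γ₃, ω₃) ← circuitLoop (fun γ ω => circuitSem φ e₃ γ ω) x (i₂ - i₁) i₁
            ((x, .nat i₁) :: γ₂) ω₂
          some (.list as, γ₃.tail, ω₃)
      | .top, _ => some (.top, γ₂, ω₂)
      | _, .top => some (.top, γ₂, ω₂)
      | _, _ => none
  | .wire _ d e, γ, ω => do
      let (v, γ₁, ω₁) ← circuitSem φ e γ ω
      match d.party with
      | none => some (v, γ₁, ω₁)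
      | some p => do
          let h ← (ω₁ p).head?
          some (h, γ₁, fun p' => if p' = p then (ω₁ p').tail else ω₁ p')
  | .cast e q, γ, ω => do
      let (v, γ₁, ω₁) ← circuitSem φ e γ ω
      some (if q.stage = .post ∨ q.dom = .pub then v else .top, γ₁, ω₁)
  | .assign l e, γ₀, ω₀ => do
      let x ← l.root
      let a ← Assoc.find γ₀ x
      let (is, γₙ, ωₙ) ← circuitIndices φ l γ₀ ω₀
      let (v, γ', ω') ← circuitSem φ e γₙ ωₙ
      let a' ← MVal.upd a is v
      some (.unit, Assoc.update γ' x a', ω')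
  | .load l e, γ₀, ω₀ => do
      let (a, γ₁, ω₁) ← circuitSem φ l γ₀ ω₀
      let (i, γ₂, ω₂) ← circuitSem φ e γ₁ ω₁
      let v ← MVal.index a i
      some (v, γ₂, ω₂)
  | .letIn _ x e₁ e₂, γ₀, ω₀ => do
      let (v₁, γ₁, ω₁) ← circuitSem φ e₁ γ₀ ω₀
      let (v₂, γ₂, ω₂) ← circuitSem φ e₂ ((x, v₁) :: γ₁) ω₁
      some (v₂, γ₂.tail, ω₂)
  | .seq e₁ e₂, γ₀, ω₀ => do
      let (_, γ₁, ω₁) ← circuitSem φ e₁ γ₀ ω₀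
      circuitSem φ e₂ γ₁ ω₁
/-- Evaluation of the indices `y₁, …, yₙ` of an L-value `x[y₁]…[yₙ]`, from left to right. -/
def circuitIndices (φ : Inputs) : Expr → Env → Streams → Option (List MVal × Env × Streams)
  | .var _, γ, ω => some ([], γ, ω)
  | .load l y, γ₀, ω₀ => do
      let (is, γ₁, ω₁) ← circuitIndices φ l γ₀ ω₀
      let (i, γ₂, ω₂) ← circuitSem φ y γ₁ ω₁
      some (is ++ [i], γ₂, ω₂)
  | _, _, _ => none
end

/-! ## Circuits -/

/-- The operations of a circuit. -/
inductive CircuitOp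
  | add
  | mul

def CircuitOp.apply : CircuitOp → ℕ → ℕ → ℕ
  | .add, a, b => a + b
  | .mul, a, b => a * b

/-- Arithmetic circuits, given by a root: constant nodes, operation nodes (addition or
multiplication modulo `N`), and input nodes (number `k` of the party `p`). -/
inductive Circuit
  | con (n : ℕ)
  | op (o : CircuitOp) (N : ℕ+) (c₁ c₂ : Circuit)
  | inp (p : Party) (k : ℕ)

/-- The value `|c|` of a circuit without its input; `none` is the unknown value. -/
def Circuit.closedValue : Circuit → Option ℕ
  | .con n => some n
  | .op o N c₁ c₂ => do
      let i₁ ← c₁.closedValue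
      let i₂ ← c₂.closedValue
      some (o.apply i₁ i₂ % (N : ℕ))
  | .inp _ _ => none

/-- Circuit inputs: a sequence of input values for each party. -/
abbrev CircuitInput := Party → List ℕ

/-- The value `c(π)` of a circuit on an input; `none` means that `π` lacks a needed input. -/
def Circuit.value (π : CircuitInput) : Circuit → Option ℕ
  | .con n => some n
  | .op o N c₁ c₂ => do
      let i₁ ← c₁.value π
      let i₂ ← c₂.value π
      some (o.apply i₁ i₂ % (N : ℕ))
  | .inp p k => (π p)[k]?

/-- A sequence of output circuits accepts `π` iff all of them evaluate to `0`. -/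
def Accepts (o : List Circuit) (π : CircuitInput) : Prop := ∀ c ∈ o, c.value π = some 0

/-! ## Compilation -/

/-- The set `M V_C`: unknown, or a pure composite value. -/
inductive CVal
  | top
  | nat (n : ℕ)
  | bool (b : Bool)
  | unit
  | list (l : List (CVal × Option Circuit))

/-- The pairs in `M V_C × M T`; a missing circuit is `none`. -/
abbrev Comp := CVal × Option Circuit

/-- Composite value environments. -/
abbrev CEnv := Assoc Comp

/-- The numbers of the input nodes created so far. -/
abbrev Counter := Party → ℕ

/-- A record of an input node: its party, its number, and the data type of the `wire` expression
that has created it. -/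
structure InputNode where
  party : Party
  number : ℕ
  type : DataType

/-- Result of compilation: composite value, environment, output circuits, counter; the last
component lists all input nodes that have been created, and nothing else depends on it. -/
abbrev CompileResult := Comp × CEnv × List Circuit × Counter × List InputNode

mutual
/-- `allpuretop`. -/
def Core.allPureTop : Core → Comp
  | .nat n => (.nat n, none)
  | .bool b => (.bool b, none)
  | .unit => (.unit, none)
  | .list l => (.list (Core.allPureTopList l), none)
def Core.allPureTopList : List Core → List Comp
  | [] => []
  | u :: l => u.allPureTop :: Core.allPureTopList l
end

/-- `do {i₁ ← v₁; i₂ ← v₂; pure (i₁ + i₂)}`; `none` means that the sum is not defined. -/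
def CVal.add (m : Option ℕ+) : CVal → CVal → Option CVal
  | .top, _ => some .top
  | _, .top => some .top
  | .nat i₁, .nat i₂ => some (.nat (reduce m (i₁ + i₂)))
  | _, _ => none

/-- The circuit of a sum, missing if a circuit of a summand is missing. (Sums of unbounded integers
exist in the stage `pre` only, where there are no circuits.) -/
def addCircuit (m : Option ℕ+) (c₁ c₂ : Option Circuit) : Option Circuit := do
  let N ← m
  let c₁ ← c₁
  let c₂ ← c₂
  some (.op .add N c₁ c₂)

/-- List lookup; `none` means that the lookup is not defined. -/
def CVal.index : CVal → CVal → Option Comp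
  | .top, _ => some (.top, none)
  | _, .top => some (.top, none)
  | .list l, .nat i => l[i]?
  | _, _ => none

/-- `upd_C`; `none` means that the update is not defined (index out of bounds). -/
def updC : Comp → List CVal → Comp → Option Comp
  | _, [], w => some w
  | (.top, _), _ :: _, _ => some (.top, none)
  | _, .top :: _, _ => some (.top, none)
  | (.list l, _), .nat i :: is, w => do
      let a ← l[i]?
      let a' ← updC a is w
      some (.list (l.set i a'), none)
  | _, _ :: _, _ => none

/-- The iterations of a `for` loop in compilation. -/
def compileLoop (body : CEnv → Counter → Option CompileResult) (x : Var) :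
    ℕ → ℕ → CEnv → Counter →
      Option (List Comp × CEnv × List Circuit × Counter × List InputNode)
  | 0, _, γ, ν => some ([], γ, [], ν, [])
  | n + 1, i, γ, ν => do
      let (a, γ₁, o₁, ν₁, ι₁) ← body (Assoc.update γ x (.nat i, none)) ν
      let (as, γ₂, o₂, ν₂, ι₂) ← compileLoop body x n (i + 1) γ₁ ν₁
      some (a :: as, γ₂, o₁ ++ o₂, ν₂, ι₁ ++ ι₂)

mutual
/-- Compilation `⟦e⟧_C γ φ ν`; `none` means that compilation fails. -/
def compile (φ : Inputs) : Expr → CEnv → Counter → Option CompileResult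
  | .eps, γ, ν => some ((.unit, none), γ, [], ν, [])
  | .natLit n _ s d, γ, ν =>
      some ((if d = .pub then .nat n else .top,
        if s = .post then some (.con n) else none), γ, [], ν, [])
  | .boolLit b _ s d, γ, ν =>
      some ((if d = .pub then .bool b else .top,
        if s = .post then some (.con (code b)) else none), γ, [], ν, [])
  | .var x, γ, ν => do
      let w ← Assoc.find γ x
      some (w, γ, [], ν, [])
  | .add m e₁ e₂, γ₀, ν₀ => do
      let ((v₁, c₁), γ₁, o₁, ν₁, ι₁) ← compile φ e₁ γ₀ ν₀
      let ((v₂, c₂), γ₂, o₂, ν₂, ι₂) ← compile φ e₂ γ₁ ν₁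
      let v ← CVal.add m v₁ v₂
      some ((v, addCircuit m c₁ c₂), γ₂, o₁ ++ o₂, ν₂, ι₁ ++ ι₂)
  | .assertion e, γ₀, ν₀ => do
      let ((_, c), γ₁, o₁, ν₁, ι₁) ← compile φ e γ₀ ν₀
      let c₁ ← c
      some ((.unit, none), γ₁, o₁ ++ [c₁], ν₁, ι₁)
  | .get d k _, γ, ν =>
      some (if d = .pub then (φ d k).allPureTop else (.top, none), γ, [], ν, [])
  | .cond e₁ e₂ e₃, γ₀, ν₀ => do
      let ((v₁, _), γ₁, o₁, ν₁, ι₁) ← compile φ e₁ γ₀ ν₀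
      match v₁ with
      | .bool true => do
          let (w, γ₂, o₂, ν₂, ι₂) ← compile φ e₂ γ₁ ν₁
          some (w, γ₂, o₁ ++ o₂, ν₂, ι₁ ++ ι₂)
      | .bool false => do
          let (w, γ₃, o₃, ν₃, ι₃) ← compile φ e₃ γ₁ ν₁
          some (w, γ₃, o₁ ++ o₃, ν₃, ι₁ ++ ι₃)
      | _ => some ((.top, none), γ₁, o₁, ν₁, ι₁)
  | .loop x e₁ e₂ e₃, γ₀, ν₀ => do
      let ((v₁, _), γ₁, o₁, ν₁, ι₁) ← compile φ e₁ γ₀ ν₀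
      let ((v₂, _), γ₂, o₂, ν₂, ι₂) ← compile φ e₂ γ₁ ν₁
      match v₁, v₂ with
      | .nat i₁, .nat i₂ => do
          let (as, γ₃, o₃, ν₃, ι₃) ← compileLoop (fun γ ν => compile φ e₃ γ ν) x (i₂ - i₁) i₁
            ((x, (.nat i₁, none)) :: γ₂) ν₂
          some ((.list as, none), γ₃.tail, o₁ ++ o₂ ++ o₃, ν₃, ι₁ ++ ι₂ ++ ι₃)
      | .top, _ => some ((.top, none), γ₂, o₁ ++ o₂, ν₂, ι₁ ++ ι₂)
      | _, .top => some ((.top, none), γ₂, o₁ ++ o₂, ν₂, ι₁ ++ ι₂)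
      | _, _ => none
  | .wire t d e, γ, ν => do
      let ((v, _), γ₁, o₁, ν₁, ι₁) ← compile φ e γ ν
      let ν₂ : Counter := fun p => if d.party = some p then ν₁ p + 1 else ν₁ p
      match v with
      | .nat n => some ((v, some (.con n)), γ₁, o₁, ν₂, ι₁)
      | .bool b => some ((v, some (.con (code b))), γ₁, o₁, ν₂, ι₁)
      | .top => do
          let p ← d.party
          some ((v, some (.inp p (ν₁ p))), γ₁, o₁, ν₂, ι₁ ++ [⟨p, ν₁ p, t⟩])
      | _ => none
  | .cast e q, γ₀, ν₀ => do
      let ((v₁, c₁), γ₁, o₁, ν₁, ι₁) ← compile φ e γ₀ ν₀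
      some ((if q.dom = .pub then v₁ else .top, if q.stage = .post then c₁ else none),
        γ₁, o₁, ν₁, ι₁)
  | .assign l e, γ₀, ν₀ => do
      let x ← l.root
      let a ← Assoc.find γ₀ x
      let (is, γₙ, oₙ, νₙ, ιₙ) ← compileIndices φ l γ₀ ν₀
      let (w, γ', o', ν', ι') ← compile φ e γₙ νₙ
      let a' ← updC a is w
      some ((.unit, none), Assoc.update γ' x a', oₙ ++ o', ν', ιₙ ++ ι')
  | .load l e, γ₀, ν₀ => do
      let ((a, _), γ₁, o₁, ν₁, ι₁) ← compile φ l γ₀ ν₀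
      let ((i, _), γ₂, o₂, ν₂, ι₂) ← compile φ e γ₁ ν₁
      let w ← CVal.index a i
      some (w, γ₂, o₁ ++ o₂, ν₂, ι₁ ++ ι₂)
  | .letIn _ x e₁ e₂, γ₀, ν₀ => do
      let (w₁, γ₁, o₁, ν₁, ι₁) ← compile φ e₁ γ₀ ν₀
      let (w₂, γ₂, o₂, ν₂, ι₂) ← compile φ e₂ ((x, w₁) :: γ₁) ν₁
      some (w₂, γ₂.tail, o₁ ++ o₂, ν₂, ι₁ ++ ι₂)
  | .seq e₁ e₂, γ₀, ν₀ => do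
      let (_, γ₁, o₁, ν₁, ι₁) ← compile φ e₁ γ₀ ν₀
      let (w₂, γ₂, o₂, ν₂, ι₂) ← compile φ e₂ γ₁ ν₁
      some (w₂, γ₂, o₁ ++ o₂, ν₂, ι₁ ++ ι₂)
/-- Compilation of the indices of an L-value, from left to right. -/
def compileIndices (φ : Inputs) : Expr → CEnv → Counter →
    Option (List CVal × CEnv × List Circuit × Counter × List InputNode)
  | .var _, γ, ν => some ([], γ, [], ν, [])
  | .load l y, γ₀, ν₀ => do
      let (is, γ₁, o₁, ν₁, ι₁) ← compileIndices φ l γ₀ ν₀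
      let ((i, _), γ₂, o₂, ν₂, ι₂) ← compile φ y γ₁ ν₁
      some (is ++ [i], γ₂, o₁ ++ o₂, ν₂, ι₁ ++ ι₂)
  | _, _, _ => none
end

/-! ## Exactness -/

/-- `v` is `pure u` with `u ∈ t`, for a primitive data type `t`. -/
def MVal.HasPrim : MVal → DataType → Prop
  | .nat _, .uint _ => True
  | .bool _, .bool _ => True
  | .unit, .unit => True
  | _, _ => False

/-- `v` is `pure u` with `u ∈ t`, for a primitive data type `t`. -/
def CVal.HasPrim : CVal → DataType → Prop
  | .nat _, .uint _ => True
  | .bool _, .bool _ => True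
  | .unit, .unit => True
  | _, _ => False

/-- `v` is `(t s d)`-exact in the predicate `P`. -/
def ExactIn (P : QType → Prop) : DataType → Stage → Domain → MVal → Prop
  | .list t' s' d', s, d, v =>
      (P ⟨.list t' s' d', s, d⟩ ∧ ∃ l, v = .list l ∧ ∀ w ∈ l, ExactIn P t' s' d' w) ∨
      (¬ P ⟨.list t' s' d', s, d⟩ ∧ v = .top)
  | t, s, d, v => (P ⟨t, s, d⟩ ∧ v.HasPrim t) ∨ (¬ P ⟨t, s, d⟩ ∧ v = .top)

/-- The types that are visible to the circuit. -/
def VisibleToCircuit (q : QType) : Prop := q.stage = .post ∨ q.dom = .pub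

/-- `γ` is `Γ`-exact in circuit. -/
def ExactInCircuit (Γ : TyEnv) (γ : Env) : Prop :=
  List.Forall₂ (fun a b => a.1 = b.1 ∧
    ExactIn VisibleToCircuit a.2.data a.2.stage a.2.dom b.2) Γ.typings γ

/-- The input dictionaries are type correct for `e`: for every subexpression `get_d(k) : q` of `e`,
the value `allpure (φ_d(k))` is `q`-exact in the domain `d`. -/
def TypeCorrectInputs (φ : Inputs) (e : Expr) : Prop :=
  ∀ d k q, (d, k, q) ∈ e.gets →
    ExactIn (fun q' => q'.dom ≤ d) q.data q.stage q.dom (φ d k).allPure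

/-- The part of exactness of a composite value that concerns the stage. -/
def StageExact (s : Stage) (w : Comp) : Prop :=
  (s = .post → ∃ c, w.2 = some c ∧
    (∀ n, w.1 = .nat n → c.closedValue = some n ∧ ∀ π, c.closedValue = c.value π) ∧
    (∀ b, w.1 = .bool b → c.closedValue = some (code b) ∧ ∀ π, c.closedValue = c.value π)) ∧
  (s = .pre → w.2 = none)

/-- The composite value `w` is `(t s d)`-exact. -/
def CompExact : DataType → Stage → Domain → Comp → Prop
  | .list t' s' d', s, d, w =>
      StageExact s w ∧
      (d = .pub → ∃ l, w.1 = .list l ∧ ∀ w' ∈ l, CompExact t' s' d' w') ∧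
      (d ≠ .pub → w.1 = .top)
  | t, s, d, w =>
      StageExact s w ∧ (d = .pub → w.1.HasPrim t) ∧ (d ≠ .pub → w.1 = .top)

/-- The composite value environment `γ` is `Γ`-exact. -/
def CEnvExact (Γ : TyEnv) (γ : CEnv) : Prop :=
  List.Forall₂ (fun a b => a.1 = b.1 ∧ CompExact a.2.data a.2.stage a.2.dom b.2) Γ.typings γ

/-! ## Correspondence of compiler states and states of the circuit semantics -/

mutual
/-- `(v, c) • π`; `none` means that `π` lacks an input that is needed. -/
def bullet (π : CircuitInput) : CVal → Option Circuit → Option MVal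
  | .nat n, _ => some (.nat n)
  | .bool b, _ => some (.nat (code b))
  | .unit, _ => some .unit
  | .list l, _ => do
      let l' ← bulletList π l
      some (.list l')
  | .top, some c => do
      let n ← c.value π
      some (.nat n)
  | .top, none => some .top
def bulletList (π : CircuitInput) : List (CVal × Option Circuit) → Option (List MVal)
  | [] => some []
  | (v, c) :: l => do
      let v' ← bullet π v c
      let l' ← bulletList π l
      some (v' :: l')
end

/-- `γ • π`. -/
def bulletEnv (π : CircuitInput) : CEnv → Option Env
  | [] => some []
  | (x, (v, c)) :: γ => do
      let v' ← bullet π v c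
      let γ' ← bulletEnv π γ
      some ((x, v') :: γ')

/-- `ν • π`. -/
def bulletCounter (ν : Counter) (π : CircuitInput) : Streams :=
  fun p => ((π p).drop (ν p)).map MVal.nat

/-- The relation `v ∼ v'` of equal encoding in the circuit. -/
inductive Sim : MVal → MVal → Prop
  | nat (n : ℕ) : Sim (.nat n) (.nat n)
  | bool (b : Bool) : Sim (.bool b) (.bool b)
  | boolNat (b : Bool) : Sim (.bool b) (.nat (code b))
  | natBool (b : Bool) : Sim (.nat (code b)) (.bool b)
  | unit : Sim .unit .unit
  | list {l l' : List MVal} (h : List.Forall₂ Sim l l') : Sim (.list l) (.list l')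
  | top : Sim .top .top

/-- `γ ∼ γ'`. -/
def EnvSim (γ γ' : Env) : Prop :=
  γ.map Prod.fst = γ'.map Prod.fst ∧
  ∀ x v v', Assoc.find γ x = some v → Assoc.find γ' x = some v' → Sim v v'

/-- `ω ∼ ω'`. -/
def StreamSim (ω ω' : Streams) : Prop := ∀ p, List.Forall₂ Sim (ω p) (ω' p)

/-- `(v, c) • π ∼ v'` (in particular, the left-hand side is defined). -/
def CompSim (w : Comp) (π : CircuitInput) (v' : MVal) : Prop :=
  ∃ v, bullet π w.1 w.2 = some v ∧ Sim v v'

/-- `γ • π ∼ γ'` (in particular, the left-hand side is defined). -/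
def CEnvSim (γ : CEnv) (π : CircuitInput) (γ' : Env) : Prop :=
  ∃ δ, bulletEnv π γ = some δ ∧ EnvSim δ γ'

/-- The streams `ω`, which supply the values for the input nodes from the number `ν_p` on, are type
correct: the value supplied for an input node that has been created by a `wire` expression of data
type `t` belongs to `t`. -/
def TypeCorrectStreams (ι : List InputNode) (ν : Counter) (ω : Streams) : Prop :=
  ∀ i ∈ ι, ∀ v, ν i.party ≤ i.number → (ω i.party)[i.number - ν i.party]? = some v →
    v.HasPrim i.type

/-- All created input nodes have a value in `π`. -/
def InputsAvailable (ι : List InputNode) (π : CircuitInput) : Prop :=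
  ∀ i ∈ ι, i.number < (π i.party).length

end ZKSC

open ZKSC

/-!
The proof is a logical relations argument. A composite value and a value of the circuit semantics
are related at a qualified type if both are exact for it and correspond to each other under the
circuit input `π`. Well-structuredness makes every part of a hidden list hidden itself, so that
lookups and updates preserve the relation even where list, index or new value is unknown. By
induction on the typing derivation, compilation and circuit semantics lead from related states to
related states. The circuit semantics can fail only in a false assertion, whose output circuit
takes the value `1`, or at an exhausted stream, where the input node just created has no entry in
`π`.

Since `γ • π ∼ γ'` says nothing about shadowed variables, environments are related by a list of
relations, one for each position, which at shadowed positions only demands that the value have an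
image under `π`.
-/

namespace ZKSC

variable {π : CircuitInput}

/-! ## Lists related entry by entry -/

section Forall₂

variable {α β γ : Type*} {R : α → β → Prop} {l : List α} {l' : List β}

theorem forall₂_exists_iff {S : β → γ → Prop} {n : List γ} :
    List.Forall₂ (fun a c => ∃ b, R a b ∧ S b c) l n ↔
      ∃ m, List.Forall₂ R l m ∧ List.Forall₂ S m n := by
  constructor
  · intro h
    induction h with
    | nil => exact ⟨[], .nil, .nil⟩
    | cons hab _ ih =>
      obtain ⟨b, hR, hS⟩ := hab
      obtain ⟨m, hRm, hSm⟩ := ih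
      exact ⟨b :: m, .cons hR hRm, .cons hS hSm⟩
  · rintro ⟨m, hR, hS⟩
    induction hR generalizing n with
    | nil => cases hS; exact .nil
    | cons hR _ ih =>
      cases hS with
      | cons hS hSm => exact .cons ⟨_, hR, hS⟩ (ih hSm)

theorem forall₂_and_right {q : β → Prop} :
    List.Forall₂ (fun a b => q b ∧ R a b) l l' ↔ (∀ b ∈ l', q b) ∧ List.Forall₂ R l l' := by
  have flipped := List.forall₂_and_left (R := flip R) (p := q) l' l
  exact ⟨fun h => (flipped.1 h.flip).imp_right List.Forall₂.flip,
    fun h => (flipped.2 (h.imp_right List.Forall₂.flip)).flip⟩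

theorem forall₂_getElem? (h : List.Forall₂ R l l') {i : ℕ} {a : α} (ha : l[i]? = some a) :
    ∃ b, l'[i]? = some b ∧ R a b := by
  obtain ⟨hi, rfl⟩ := List.getElem?_eq_some_iff.1 ha
  have hi' : i < l'.length := h.length_eq ▸ hi
  exact ⟨l'[i], List.getElem?_eq_getElem hi', h.get hi hi'⟩

theorem forall₂_set (h : List.Forall₂ R l l') (i : ℕ) {a : α} {b : β} (hab : R a b) :
    List.Forall₂ R (l.set i a) (l'.set i b) := by
  induction h generalizing i with
  | nil => exact .nil
  | cons h₀ h ih =>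
    cases i with
    | zero => exact .cons hab h
    | succ i => exact .cons h₀ (ih i)

end Forall₂

/-! ## Related values -/

/-- The logical relation at the qualified type `q`: the composite value `w` of the compiler and the
value `v'` of the circuit semantics are exact for `q` and correspond under `π`. -/
def ValRel (π : CircuitInput) (q : QType) (w : Comp) (v' : MVal) : Prop :=
  CompExact q.data q.stage q.dom w ∧ ExactIn VisibleToCircuit q.data q.stage q.dom v' ∧
    CompSim w π v'

theorem bulletList_eq_some_iff {l : List Comp} {m : List MVal} :
    bulletList π l = some m ↔ List.Forall₂ (fun w v => bullet π w.1 w.2 = some v) l m := by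
  induction l generalizing m with
  | nil => simp [bulletList, eq_comm]
  | cons w l ih =>
    simp [bulletList, List.forall₂_cons_left_iff, ← ih, Option.bind_eq_some_iff, eq_comm (a := m)]

theorem compSim_list_iff {l : List Comp} {c : Option Circuit} {l' : List MVal} :
    CompSim (.list l, c) π (.list l') ↔ List.Forall₂ (fun w v' => CompSim w π v') l l' := by
  have sim_list (m : List MVal) : Sim (.list m) (.list l') ↔ List.Forall₂ Sim m l' :=
    ⟨fun h => by cases h; assumption, .list⟩
  simp [CompSim, forall₂_exists_iff, bullet, Option.bind_eq_some_iff, bulletList_eq_some_iff,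
    sim_list]

theorem compExact_hidden_iff {t : DataType} {d : Domain} (hd : d ≠ .pub) {w : Comp} :
    CompExact t .pre d w ↔ w = (.top, none) := by
  obtain ⟨v, c⟩ := w
  cases t <;> simp [CompExact, StageExact, hd, and_comm]

theorem exactIn_hidden_iff {t : DataType} {d : Domain} (hd : d ≠ .pub) {v' : MVal} :
    ExactIn VisibleToCircuit t .pre d v' ↔ v' = .top := by
  cases t <;> simp [ExactIn, VisibleToCircuit, hd]

theorem valRel_hidden_iff {t : DataType} {d : Domain} (hd : d ≠ .pub) {w : Comp} {v' : MVal} :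
    ValRel π ⟨t, .pre, d⟩ w v' ↔ w = (.top, none) ∧ v' = .top := by
  have top_sim : CompSim (.top, none) π .top := ⟨.top, by simp [bullet], .top⟩
  simp only [ValRel, compExact_hidden_iff hd, exactIn_hidden_iff hd]
  exact ⟨fun ⟨hw, hv, _⟩ => ⟨hw, hv⟩, fun ⟨hw, hv⟩ => ⟨hw, hv, hw ▸ hv ▸ top_sim⟩⟩

theorem valRel_list_iff {t : DataType} {s : Stage} {d : Domain} {w : Comp} {v' : MVal} :
    ValRel π ⟨.list t s d, .pre, .pub⟩ w v' ↔
      ∃ l l', w = (.list l, none) ∧ v' = .list l' ∧ List.Forall₂ (ValRel π ⟨t, s, d⟩) l l' := by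
  have compExact_iff : CompExact (.list t s d) .pre .pub w ↔
      ∃ l, w = (.list l, none) ∧ ∀ w ∈ l, CompExact t s d w := by
    obtain ⟨v, c⟩ := w
    simp [CompExact, StageExact, and_comm, and_assoc]
  have exactIn_iff : ExactIn VisibleToCircuit (.list t s d) .pre .pub v' ↔
      ∃ l', v' = .list l' ∧ ∀ v ∈ l', ExactIn VisibleToCircuit t s d v := by
    simp [ExactIn, VisibleToCircuit]
  have forall₂_valRel_iff (l : List Comp) (l' : List MVal) :
      List.Forall₂ (ValRel π ⟨t, s, d⟩) l l' ↔ (∀ w ∈ l, CompExact t s d w) ∧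
        (∀ v ∈ l', ExactIn VisibleToCircuit t s d v) ∧ CompSim (.list l, none) π (.list l') := by
    rw [compSim_list_iff, ← forall₂_and_right, ← List.forall₂_and_left]
    rfl
  simp only [ValRel, compExact_iff, exactIn_iff]
  constructor
  · rintro ⟨⟨l, rfl, hl⟩, ⟨l', rfl, hl'⟩, hs⟩
    exact ⟨l, l', rfl, rfl, (forall₂_valRel_iff l l').2 ⟨hl, hl', hs⟩⟩
  · rintro ⟨l, l', rfl, rfl, h⟩
    obtain ⟨hl, hl', hs⟩ := (forall₂_valRel_iff l l').1 h
    exact ⟨⟨l, rfl, hl⟩, ⟨l', rfl, hl'⟩, hs⟩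

theorem valRel_unit (π : CircuitInput) : ValRel π ⟨.unit, .pre, .pub⟩ (.unit, none) .unit := by
  simp [ValRel, CompExact, StageExact, ExactIn, VisibleToCircuit, CompSim, bullet,
    CVal.HasPrim, MVal.HasPrim, Sim.unit]

/-! ## Related scalars -/

/-- The circuit `c` has the value `n` on every input. -/
def ConstCircuit (c : Circuit) (n : ℕ) : Prop :=
  c.closedValue = some n ∧ ∀ π, c.closedValue = c.value π

theorem constCircuit_con (n : ℕ) : ConstCircuit (.con n) n := ⟨rfl, fun _ => rfl⟩

theorem ConstCircuit.value {c : Circuit} {n : ℕ} (h : ConstCircuit c n) (π : CircuitInput) :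
    c.value π = some n := (h.2 π).symm.trans h.1

/-- The data types whose values are single numbers in a circuit. -/
def DataType.IsScalar : DataType → Prop
  | .uint _ => True
  | .bool _ => True
  | _ => False

/-- `Encodes t v v' n`: the compiler value `v` and the value `v'` of the circuit semantics are the
same known element of the scalar type `t`, represented in circuits by the number `n`. -/
inductive Encodes : DataType → CVal → MVal → ℕ → Prop
  | nat (m : Option ℕ+) (n : ℕ) : Encodes (.uint m) (.nat n) (.nat n) n
  | bool (m : Option ℕ+) (b : Bool) : Encodes (.bool m) (.bool b) (.bool b) (code b)

section Scalars

variable {t : DataType} {v : CVal} {v' : MVal} {n : ℕ}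

theorem code_injective : Function.Injective code := by
  intro a b; cases a <;> cases b <;> simp [code]

theorem Encodes.compHasPrim (h : Encodes t v v' n) : v.HasPrim t := by
  cases h <;> trivial

theorem Encodes.hasPrim (h : Encodes t v v' n) : v'.HasPrim t := by
  cases h <;> trivial

theorem exists_encodes_of_compHasPrim (ht : t.IsScalar) (h : v.HasPrim t) :
    ∃ v' n, Encodes t v v' n := by
  cases t <;> cases v <;> first | exact h.elim | exact ht.elim | exact ⟨_, _, by constructor⟩

theorem exists_encodes_of_hasPrim (ht : t.IsScalar) (h : v'.HasPrim t) :
    ∃ v n, Encodes t v v' n := by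
  cases t <;> cases v' <;> first | exact h.elim | exact ht.elim | exact ⟨_, _, by constructor⟩

theorem Encodes.bullet_eq (h : Encodes t v v' n) (c : Option Circuit) :
    bullet π v c = some (.nat n) := by
  cases h <;> simp [bullet]

theorem Encodes.sim_iff (h : Encodes t v v' n) {k : ℕ} : Sim (.nat k) v' ↔ k = n := by
  cases h with
  | nat m n => exact ⟨fun h => by cases h; rfl, fun h => h ▸ .nat k⟩
  | bool m b => exact ⟨fun h => by cases h; rfl, fun h => h ▸ .natBool b⟩

theorem Encodes.of_code_eq {u : CVal} {u' : MVal} (h : Encodes t v u' n)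
    (hu : Encodes t u v' n) : Encodes t v v' n := by
  cases h with
  | nat m n => cases hu; exact .nat m n
  | bool m b =>
    generalize hk : code b = k at hu
    cases hu with
    | bool m b' => cases code_injective hk; exact .bool m b

/-- The possible forms of related values of the scalar type `t`, by stage and domain. -/
inductive ScalarRel (π : CircuitInput) (t : DataType) : Stage → Domain → Comp → MVal → Prop
  | hidden {d : Domain} (hd : d ≠ .pub) : ScalarRel π t .pre d (.top, none) .top
  | known {v : CVal} {v' : MVal} {n : ℕ} (h : Encodes t v v' n) :
      ScalarRel π t .pre .pub (v, none) v'
  | constant {v : CVal} {v' : MVal} {n : ℕ} {c : Circuit} (h : Encodes t v v' n)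
      (hc : ConstCircuit c n) : ScalarRel π t .post .pub (v, some c) v'
  | secret {d : Domain} {v : CVal} {v' : MVal} {n : ℕ} {c : Circuit} (hd : d ≠ .pub)
      (h : Encodes t v v' n) (hc : c.value π = some n) : ScalarRel π t .post d (.top, some c) v'

theorem compExact_scalar_iff (ht : t.IsScalar) {s : Stage} {d : Domain} {w : Comp} :
    CompExact t s d w ↔
      StageExact s w ∧ (d = .pub → w.1.HasPrim t) ∧ (d ≠ .pub → w.1 = .top) := by
  cases t <;> first | exact ht.elim | rfl

theorem exactIn_scalar_iff (ht : t.IsScalar) {s : Stage} {d : Domain}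
    (h : s = .post ∨ d = .pub) : ExactIn VisibleToCircuit t s d v' ↔ v'.HasPrim t := by
  cases t <;> first | exact ht.elim | simp [ExactIn, VisibleToCircuit, h]

theorem Encodes.stageExact_post_iff (h : Encodes t v v' n) {c : Circuit} :
    StageExact .post (v, some c) ↔ ConstCircuit c n := by
  cases h <;> simp [StageExact, ConstCircuit]

theorem ScalarRel.valRel {s : Stage} {d : Domain} {w : Comp} (ht : t.IsScalar)
    (h : ScalarRel π t s d w v') : ValRel π ⟨t, s, d⟩ w v' := by
  cases h with
  | hidden hd => exact (valRel_hidden_iff hd).2 ⟨rfl, rfl⟩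
  | known h =>
    exact ⟨(compExact_scalar_iff ht).2 ⟨by simp [StageExact], fun _ => h.compHasPrim, by simp⟩,
      (exactIn_scalar_iff ht (.inr rfl)).2 h.hasPrim, _, h.bullet_eq _, h.sim_iff.2 rfl⟩
  | constant h hc =>
    exact ⟨(compExact_scalar_iff ht).2 ⟨h.stageExact_post_iff.2 hc, fun _ => h.compHasPrim,
      by simp⟩, (exactIn_scalar_iff ht (.inr rfl)).2 h.hasPrim, _, h.bullet_eq _, h.sim_iff.2 rfl⟩
  | secret hd h hc =>
    exact ⟨(compExact_scalar_iff ht).2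
      ⟨by simp [StageExact], fun hd' => (hd hd').elim, fun _ => rfl⟩,
      (exactIn_scalar_iff ht (.inl rfl)).2 h.hasPrim, _, by simp [bullet, hc], h.sim_iff.2 rfl⟩

theorem ValRel.scalarRel {s : Stage} {d : Domain} {w : Comp} (h : ValRel π ⟨t, s, d⟩ w v')
    (ht : t.IsScalar) : ScalarRel π t s d w v' := by
  obtain ⟨v, c⟩ := w
  obtain ⟨hw, hv', u, hu, hsim⟩ := id h
  obtain ⟨hstage, hpub, hhidden⟩ := (compExact_scalar_iff ht).1 hw
  by_cases hd : d = .pub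
  · obtain ⟨_, n, henc⟩ := exists_encodes_of_compHasPrim ht (hpub hd)
    obtain ⟨_, k, henc'⟩ := exists_encodes_of_hasPrim ht ((exactIn_scalar_iff ht (.inr hd)).1 hv')
    cases (henc.bullet_eq c).symm.trans hu
    cases henc'.sim_iff.1 hsim
    replace henc := henc.of_code_eq henc'
    subst hd
    cases s with
    | pre => cases hstage.2 rfl; exact .known henc
    | post =>
      obtain ⟨c, rfl, -⟩ := hstage.1 rfl
      exact .constant henc (henc.stageExact_post_iff.1 hstage)
  · cases s with
    | pre =>
      obtain ⟨hw, rfl⟩ := (valRel_hidden_iff hd).1 h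
      cases hw
      exact .hidden hd
    | post =>
      obtain ⟨c, rfl, -⟩ := hstage.1 rfl
      obtain ⟨_, k, henc⟩ := exists_encodes_of_hasPrim ht ((exactIn_scalar_iff ht (.inl rfl)).1 hv')
      obtain rfl : v = .top := hhidden hd
      obtain ⟨n, hc, ⟨⟩⟩ : ∃ n, c.value π = some n ∧ MVal.nat n = u := by
        simpa [bullet, Option.bind_eq_some_iff] using hu
      exact .secret hd henc (henc.sim_iff.1 hsim ▸ hc)

end Scalars

/-! ## Stages, domains and well-structured types -/

theorem Domain.le_pub_iff {d : Domain} : d ≤ .pub ↔ d = .pub := by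
  change d.rank ≤ Domain.rank .pub ↔ _
  cases d <;> simp [Domain.rank]

theorem Domain.pub_mem_up_iff {d : Domain} : Domain.pub ∈ d.up ↔ d = .pub :=
  Domain.le_pub_iff

theorem Domain.party_eq_none_iff {d : Domain} : d.party = none ↔ d = .pub := by
  cases d <;> simp [Domain.party]

theorem Stage.pub_mem_up_iff {s : Stage} : Domain.pub ∈ s.up ↔ s = .post := by
  cases s <;> simp [Stage.up, Domain.pub_mem_up_iff]

theorem Stage.eq_pre_of_pre_le {s : Stage} (h : Stage.pre ≤ s) : s = .pre := by
  cases s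
  · exact absurd h (Nat.not_succ_le_zero 0)
  · rfl

section Types

variable {t : DataType} {s s' : Stage} {d d' : Domain}

theorem hidden_of_up_subset (h : s.up ∪ d.up ⊆ d'.up) (hd' : d' ≠ .pub) :
    s = .pre ∧ d ≠ .pub := by
  have pub_notMem : Domain.pub ∉ s.up ∪ d.up := fun hmem =>
    hd' (Domain.pub_mem_up_iff.1 (h hmem))
  rw [Set.mem_union, Stage.pub_mem_up_iff, Domain.pub_mem_up_iff, not_or] at pub_notMem
  cases s <;> simp_all

theorem WellStructured.isScalar (h : WellStructured t .post d) : t.IsScalar := by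
  cases t with
  | uint | bool => trivial
  | unit => cases h
  | list => cases h.1

theorem eq_of_allPre (h : allPre d' t s d) : s = .pre ∧ d = d' := by
  cases t with
  | list => exact ⟨h.1, h.2.1⟩
  | _ => exact h

theorem wellStructured_of_allPre (h : allPre d' t s d) : WellStructured t s d := by
  induction t generalizing s d with
  | uint | bool => trivial
  | unit => exact h.1
  | list t₁ s₁ d₁ ih =>
    obtain ⟨rfl, rfl, h⟩ := h
    obtain ⟨rfl, rfl⟩ := eq_of_allPre h
    exact ⟨rfl, by simp [Stage.up], ih h⟩

theorem WellStructured.cast (h : WellStructured t s d) (hs : s ≤ s') (ht : t.up ⊆ d'.up) :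
    WellStructured t s' d' := by
  cases t with
  | uint | bool => trivial
  | unit => cases h; exact Stage.eq_pre_of_pre_le hs
  | list t₁ s₁ d₁ =>
    obtain ⟨rfl, -, h₁⟩ := h
    rw [DataType.up, Set.union_assoc] at ht
    exact ⟨Stage.eq_pre_of_pre_le hs, Set.subset_union_right.trans ht, h₁⟩

end Types

theorem TyEnv.WellStructured.lookupType {Γ : TyEnv} (hΓ : Γ.WellStructured) {x : Var} {q : QType}
    (h : Γ.lookupType x = some q) : ZKSC.WellStructured q.data q.stage q.dom := by
  have mem_typings : ∀ Γ : TyEnv, Γ.lookupType x = some q → (x, q) ∈ Γ.typings := by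
    intro Γ h
    induction Γ with
    | nil => simp [TyEnv.lookupType] at h
    | cons a Γ ih => cases a <;> grind [TyEnv.lookupType, TyEnv.typings]
  exact hΓ _ (mem_typings Γ h)

theorem TyEnv.WellStructured.cons_typing {Γ : TyEnv} (hΓ : Γ.WellStructured) (x : Var) {q : QType}
    (hq : ZKSC.WellStructured q.data q.stage q.dom) : TyEnv.WellStructured (.typing x q :: Γ) :=
  List.forall_mem_cons.2 ⟨hq, hΓ⟩

theorem HasType.wellStructured {Γ : TyEnv} {e : Expr} {q : QType} {D : Set Domain}
    (h : HasType Γ e q D) (hΓ : Γ.WellStructured) : WellStructured q.data q.stage q.dom := by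
  induction h with
  | eps | assertion | assign => rfl
  | natLit | boolLit | add => trivial
  | var h => exact hΓ.lookupType h
  | get h => exact wellStructured_of_allPre h
  | cond _ _ _ _ _ ih _ => exact ih hΓ
  | loop _ _ _ hd _ _ ih =>
    exact ⟨rfl, Set.subset_union_left.trans hd, ih (hΓ.cons_typing _ trivial)⟩
  | wire ht _ _ => rcases ht with rfl | rfl <;> trivial
  | cast _ hs _ ht ih => exact (ih hΓ).cast hs ht
  | load _ _ _ ih _ => exact (ih hΓ).2.2
  | letIn _ _ ih₁ ih₂ => exact ih₂ (hΓ.cons_typing _ (ih₁ hΓ))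
  | seq _ _ _ ih => exact ih hΓ

/-! ## Operations on related values -/

section Operations

variable {t : DataType} {s s' : Stage} {d d' : Domain} {m : Option ℕ+} {w w₁ w₂ : Comp}
  {v' v₁' v₂' : MVal}

theorem ValRel.exists_eq_nat (h : ValRel π ⟨.uint m, .pre, .pub⟩ w v') :
    ∃ n, w = (.nat n, none) ∧ v' = .nat n := by
  cases h.scalarRel trivial with
  | hidden hd => exact (hd rfl).elim
  | known h => cases h; exact ⟨_, rfl, rfl⟩

theorem valRel_nat (m : Option ℕ+) (n : ℕ) :
    ValRel π ⟨.uint m, .pre, .pub⟩ (.nat n, none) (.nat n) :=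
  (ScalarRel.known (.nat m n)).valRel trivial

theorem valRel_top (t : DataType) (hd : d ≠ .pub) : ValRel π ⟨t, .pre, d⟩ (.top, none) .top :=
  (valRel_hidden_iff hd).2 ⟨rfl, rfl⟩

theorem Encodes.isScalar {v : CVal} {n : ℕ} (h : Encodes t v v' n) : t.IsScalar := by
  cases h <;> trivial

theorem Encodes.valRel_literal {v : CVal} {n : ℕ} (h : Encodes t v v' n) (s : Stage)
    (d : Domain) :
    ValRel π ⟨t, s, d⟩ (if d = .pub then v else .top, if s = .post then some (.con n) else none)
      (if s = .post ∨ d = .pub then v' else .top) := by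
  refine ScalarRel.valRel h.isScalar ?_
  by_cases hd : d = .pub <;> cases s <;> simp only [hd, if_true, if_false, or_true, or_false,
    reduceCtorEq]
  exacts [.constant h (constCircuit_con n), .known h, .secret hd h rfl, .hidden hd]

theorem ConstCircuit.add {c₁ c₂ : Circuit} {n₁ n₂ : ℕ} (h₁ : ConstCircuit c₁ n₁)
    (h₂ : ConstCircuit c₂ n₂) (N : ℕ+) :
    ConstCircuit (.op .add N c₁ c₂) ((n₁ + n₂) % (N : ℕ)) := by
  refine ⟨by simp [Circuit.closedValue, h₁.1, h₂.1, CircuitOp.apply], fun π => ?_⟩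
  simp [Circuit.closedValue, Circuit.value, h₁.1, h₂.1, h₁.value π, h₂.value π]

theorem ValRel.add (hm : m = none → s = .pre) (h₁ : ValRel π ⟨.uint m, s, d⟩ w₁ v₁')
    (h₂ : ValRel π ⟨.uint m, s, d⟩ w₂ v₂') {v : CVal} (hv : CVal.add m w₁.1 w₂.1 = some v) :
    ∃ v', MVal.add m v₁' v₂' = some v' ∧
      ValRel π ⟨.uint m, s, d⟩ (v, addCircuit m w₁.2 w₂.2) v' := by
  suffices ∃ v', MVal.add m v₁' v₂' = some v' ∧
      ScalarRel π (.uint m) s d (v, addCircuit m w₁.2 w₂.2) v' from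
    this.imp fun v' hv' => hv'.imp_right (ScalarRel.valRel trivial)
  have some_of_post (hs : s = .post) : ∃ N, m = some N :=
    Option.ne_none_iff_exists'.1 fun h => by cases hs.symm.trans (hm h)
  cases h₁.scalarRel trivial with
  | hidden hd =>
    cases hv
    exact ⟨.top, rfl, by cases m <;> exact .hidden hd⟩
  | known h₁ =>
    cases h₂.scalarRel trivial with
    | hidden hd => exact (hd rfl).elim
    | known h₂ =>
      cases h₁; cases h₂; cases hv
      exact ⟨_, rfl, by cases m <;> exact .known (.nat _ _)⟩
  | constant h₁ hc₁ =>
    obtain ⟨N, rfl⟩ := some_of_post rfl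
    cases h₂.scalarRel trivial with
    | constant h₂ hc₂ =>
      cases h₁; cases h₂; cases hv
      exact ⟨_, rfl, .constant (.nat _ _) (hc₁.add hc₂ N)⟩
    | secret hd => exact (hd rfl).elim
  | secret hd h₁ hc₁ =>
    obtain ⟨N, rfl⟩ := some_of_post rfl
    cases h₂.scalarRel trivial with
    | constant => exact (hd rfl).elim
    | secret _ h₂ hc₂ =>
      cases h₁; cases h₂; cases hv
      exact ⟨_, rfl, .secret hd (.nat _ _)
        (by simp [Circuit.value, hc₁, hc₂, CircuitOp.apply, reduce])⟩

theorem CompExact.circuit_eq_none (h : CompExact t .pre d w) : w.2 = none := by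
  cases t <;> exact h.1.2 rfl

theorem ValRel.cast (h : ValRel π ⟨t, s, d⟩ w v') (ht : WellStructured t s d) (hs : s ≤ s')
    (hd : d ≤ d') :
    ValRel π ⟨t, s', d'⟩ (if d' = .pub then w.1 else .top, if s' = .post then w.2 else none)
      (if s' = .post ∨ d' = .pub then v' else .top) := by
  by_cases hd' : d' = .pub
  · subst hd'
    obtain rfl := Domain.le_pub_iff.1 hd
    cases s with
    | pre =>
      obtain rfl := Stage.eq_pre_of_pre_le hs
      simpa [← h.1.circuit_eq_none] using h
    | post =>
      cases h.scalarRel ht.isScalar with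
      | constant henc hc =>
        cases s'
        exacts [(ScalarRel.constant henc hc).valRel ht.isScalar,
          (ScalarRel.known henc).valRel ht.isScalar]
      | secret hd => exact (hd rfl).elim
  · cases s' with
    | pre => simpa [hd'] using valRel_top t hd'
    | post =>
      cases s with
      | pre => cases Stage.eq_pre_of_pre_le hs
      | post =>
        refine ScalarRel.valRel ht.isScalar ?_
        simp only [hd', if_false, if_true, true_or]
        cases h.scalarRel ht.isScalar with
        | constant henc hc => exact .secret hd' henc (hc.value π)
        | secret _ henc hc => exact .secret hd' henc hc

theorem ValRel.index (ht : WellStructured (.list t s d) s' d') {a i : Comp} {a' i' : MVal}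
    (ha : ValRel π ⟨.list t s d, s', d'⟩ a a') (hi : ValRel π ⟨.uint m, s', d'⟩ i i')
    (hw : CVal.index a.1 i.1 = some w) :
    ∃ v', MVal.index a' i' = some v' ∧ ValRel π ⟨t, s, d⟩ w v' := by
  obtain ⟨rfl, hsd, -⟩ := ht
  by_cases hd : d' = .pub
  · subst hd
    obtain ⟨l, l', rfl, rfl, hl⟩ := valRel_list_iff.1 ha
    obtain ⟨n, rfl, rfl⟩ := hi.exists_eq_nat
    exact forall₂_getElem? hl hw
  · obtain ⟨rfl, rfl⟩ := (valRel_hidden_iff hd).1 ha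
    obtain ⟨rfl, hd₁⟩ := hidden_of_up_subset hsd hd
    cases hw
    exact ⟨.top, rfl, valRel_top t hd₁⟩

end Operations

theorem allPureList_eq_map (l : List Core) : Core.allPureList l = l.map Core.allPure := by
  induction l with
  | nil => rfl
  | cons u l ih => simp [Core.allPureList, ih]

theorem allPureTopList_eq_map (l : List Core) :
    Core.allPureTopList l = l.map Core.allPureTop := by
  induction l with
  | nil => rfl
  | cons u l ih => simp [Core.allPureTopList, ih]

theorem valRel_allPure {t : DataType} {s : Stage} {d : Domain} (ht : allPre .pub t s d) {u : Core}
    (hu : ExactIn (fun q => q.dom ≤ .pub) t s d u.allPure) :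
    ValRel π ⟨t, s, d⟩ u.allPureTop u.allPure := by
  obtain ⟨rfl, rfl⟩ := eq_of_allPre ht
  have hle : Domain.pub ≤ .pub := Domain.le_pub_iff.2 rfl
  induction t generalizing u with
  | uint m =>
    obtain ⟨n, rfl⟩ : ∃ n, u = .nat n := by
      cases u <;> simp [ExactIn, hle, Core.allPure, MVal.HasPrim] at hu ⊢
    exact valRel_nat m n
  | bool m =>
    obtain ⟨b, rfl⟩ : ∃ b, u = .bool b := by
      cases u <;> simp [ExactIn, hle, Core.allPure, MVal.HasPrim] at hu ⊢
    exact (ScalarRel.known (.bool m b)).valRel trivial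
  | unit =>
    obtain rfl : u = .unit := by
      cases u <;> simp [ExactIn, hle, Core.allPure, MVal.HasPrim] at hu ⊢
    exact valRel_unit π
  | list t₁ s₁ d₁ ih =>
    obtain ⟨rfl, rfl⟩ := eq_of_allPre ht.2.2
    obtain ⟨l, rfl, hl⟩ : ∃ l, u = .list l ∧
        ∀ v ∈ l, ExactIn (fun q => q.dom ≤ .pub) t₁ .pre .pub v.allPure := by
      cases u with
      | list l =>
        exact ⟨l, rfl, by simpa [ExactIn, hle, Core.allPure, allPureList_eq_map] using hu⟩
      | _ => simp [ExactIn, hle, Core.allPure] at hu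
    refine valRel_list_iff.2 ⟨_, _, rfl, rfl, ?_⟩
    rw [allPureList_eq_map, allPureTopList_eq_map, List.forall₂_map_left_iff,
      List.forall₂_map_right_iff, List.forall₂_same]
    exact fun v hv => ih ht.2.2 (hl v hv)

/-- Related index lists `is` and `is'` of an L-value whose variable has the type `q₀` and whose own
type is `q`. -/
inductive PathRel (π : CircuitInput) : QType → List CVal → List MVal → QType → Prop
  | nil {q : QType} : PathRel π q [] [] q
  | cons {t : DataType} {s s' : Stage} {d d' : Domain} {i : Comp} {i' : MVal} {is : List CVal}
      {is' : List MVal} {q : QType} (hi : ValRel π ⟨.uint none, s', d'⟩ i i')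
      (h : PathRel π ⟨t, s, d⟩ is is' q) :
      PathRel π ⟨.list t s d, s', d'⟩ (i.1 :: is) (i' :: is') q

section Paths

variable {q₀ q : QType} {is : List CVal} {is' : List MVal}

theorem PathRel.concat {t : DataType} {s s' : Stage} {d d' : Domain}
    (h : PathRel π q₀ is is' ⟨.list t s d, s', d'⟩) {i : Comp} {i' : MVal}
    (hi : ValRel π ⟨.uint none, s', d'⟩ i i') :
    PathRel π q₀ (is ++ [i.1]) (is' ++ [i']) ⟨t, s, d⟩ := by
  generalize hq : QType.mk (.list t s d) s' d' = q at h
  induction h with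
  | nil => subst hq; exact .cons hi .nil
  | cons hj _ ih => exact .cons hj (ih hq)

theorem PathRel.upd (h : PathRel π q₀ is is' q) (hq₀ : WellStructured q₀.data q₀.stage q₀.dom)
    {a w r : Comp} {a' w' : MVal} (ha : ValRel π q₀ a a') (hw : ValRel π q w w')
    (hr : updC a is w = some r) :
    ∃ r', MVal.upd a' is' w' = some r' ∧ ValRel π q₀ r r' := by
  induction h generalizing a a' r with
  | nil =>
    simp only [updC, Option.some.injEq] at hr
    exact ⟨w', by simp [MVal.upd], hr ▸ hw⟩
  | @cons t s s' d d' i i' is is' q hi _ ih =>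
    obtain ⟨rfl, -, ht⟩ := hq₀
    by_cases hd : d' = .pub
    · subst hd
      obtain ⟨l, l', rfl, rfl, hl⟩ := valRel_list_iff.1 ha
      obtain ⟨n, rfl, rfl⟩ := hi.exists_eq_nat
      simp only [updC, Option.bind_eq_bind, Option.bind_eq_some_iff, Option.some.injEq] at hr
      obtain ⟨b, hb, r₁, hr₁, rfl⟩ := hr
      obtain ⟨b', hb', hbb⟩ := forall₂_getElem? hl hb
      obtain ⟨r₁', hr₁', hrr⟩ := ih ht hbb hw hr₁
      refine ⟨.list (l'.set n r₁'), by simp [MVal.upd, hb', hr₁'], ?_⟩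
      exact valRel_list_iff.2 ⟨_, _, rfl, rfl, forall₂_set hl n hrr⟩
    · obtain ⟨rfl, rfl⟩ := (valRel_hidden_iff hd).1 ha
      simp only [updC, Option.some.injEq] at hr
      exact ⟨.top, by simp [MVal.upd], hr ▸ valRel_top _ hd⟩

end Paths

/-! ## Related environments -/

/-- `EnvRel Δ γ γ'`: the environments `γ` and `γ'` bind the same variables in the same order, and
at each position the two values are related by the relation at this position of `Δ`. -/
inductive EnvRel {α β : Type} : Assoc (α → β → Prop) → Assoc α → Assoc β → Prop
  | nil : EnvRel [] [] []
  | cons {x : Var} {R : α → β → Prop} {a : α} {b : β} {Δ : Assoc (α → β → Prop)} {γ : Assoc α}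
      {γ' : Assoc β} (hab : R a b) (h : EnvRel Δ γ γ') :
      EnvRel ((x, R) :: Δ) ((x, a) :: γ) ((x, b) :: γ')

section EnvRel

variable {α β : Type} {Δ : Assoc (α → β → Prop)} {γ : Assoc α} {γ' : Assoc β} {x : Var}
  {R : α → β → Prop} {a : α}

theorem EnvRel.find (h : EnvRel Δ γ γ') (hR : Assoc.find Δ x = some R)
    (ha : Assoc.find γ x = some a) : ∃ b, Assoc.find γ' x = some b ∧ R a b := by
  induction h with
  | nil => cases hR
  | cons hab _ ih =>
    simp only [Assoc.find] at hR ha ⊢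
    split_ifs at hR ha ⊢
    · cases hR; cases ha
      exact ⟨_, rfl, hab⟩
    · exact ih hR ha

theorem EnvRel.update (h : EnvRel Δ γ γ') (hR : Assoc.find Δ x = some R) {b : β} (hab : R a b) :
    EnvRel Δ (Assoc.update γ x a) (Assoc.update γ' x b) := by
  induction h with
  | nil => exact .nil
  | @cons y S a₀ b₀ Δ γ γ' h₀ h ih =>
    by_cases hyx : y = x
    · obtain rfl : S = R := by simpa [Assoc.find, hyx] using hR
      simpa only [Assoc.update, if_pos hyx] using .cons hab h
    · simpa only [Assoc.update, if_neg hyx] using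
        .cons h₀ (ih (by simpa [Assoc.find, hyx] using hR))

theorem EnvRel.tail (h : EnvRel ((x, R) :: Δ) γ γ') : EnvRel Δ γ.tail γ'.tail := by
  cases h; assumption

end EnvRel

/-- Through the relations in `Δ`, every typed variable of `Γ` denotes values related at its
type. -/
def Models (π : CircuitInput) (Γ : TyEnv) (Δ : Assoc (Comp → MVal → Prop)) : Prop :=
  ∀ x q, Γ.lookupType x = some q → Assoc.find Δ x = some (ValRel π q)

theorem Models.cons {Γ : TyEnv} {Δ : Assoc (Comp → MVal → Prop)} (h : Models π Γ Δ) (x : Var)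
    (q : QType) : Models π (.typing x q :: Γ) ((x, ValRel π q) :: Δ) := by
  intro y q' hq'
  simp only [TyEnv.lookupType, Assoc.find] at hq' ⊢
  split_ifs with hxy
  · rw [if_pos hxy] at hq'
    rw [Option.some.inj hq']
  · rw [if_neg hxy] at hq'
    exact h y q' hq'

/-- The relations at the positions of an environment with the given typings: at the first binding
of a variable outside `seen`, values are related at its type; at the other bindings, which cannot be
accessed, the left value merely has an image under `π`. -/
def accessRel (π : CircuitInput) : List Var → Assoc QType → Assoc (Comp → MVal → Prop)
  | _, [] => []
  | seen, (x, q) :: Θ =>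
    (x, if x ∈ seen then fun w _ => (bullet π w.1 w.2).isSome else ValRel π q) ::
      accessRel π (x :: seen) Θ

section AccessRel

variable {seen : List Var} {Θ : Assoc QType} {x : Var} {w : Comp} {v' : MVal}

theorem find_accessRel (hx : x ∉ seen) :
    Assoc.find (accessRel π seen Θ) x = (Assoc.find Θ x).map (ValRel π) := by
  induction Θ generalizing seen with
  | nil => rfl
  | cons a Θ ih => grind [accessRel, Assoc.find]

theorem models_accessRel (Γ : TyEnv) : Models π Γ (accessRel π [] Γ.typings) := by
  intro x q hq
  have find_typings : Assoc.find Γ.typings x = Γ.lookupType x := by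
    clear hq
    induction Γ with
    | nil => rfl
    | cons a Γ ih => cases a <;> simp [TyEnv.typings, TyEnv.lookupType, Assoc.find, ih]
  rw [find_accessRel List.not_mem_nil, find_typings, hq, Option.map_some]

theorem isSome_bullet_of_mem_accessRel {R : Comp → MVal → Prop}
    (hR : (x, R) ∈ accessRel π seen Θ) (h : R w v') : (bullet π w.1 w.2).isSome := by
  induction Θ generalizing seen with
  | nil => cases hR
  | cons a Θ ih =>
    rcases List.mem_cons.1 hR with hR | hR
    · cases hR
      split_ifs at h with hx
      · exact h
      · obtain ⟨-, -, v, hv, -⟩ := h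
        exact Option.isSome_of_mem hv
    · exact ih hR

theorem envRel_accessRel {γ : CEnv} {δ γ' : Env}
    (hγ : List.Forall₂ (fun a b => a.1 = b.1 ∧ CompExact a.2.data a.2.stage a.2.dom b.2) Θ γ)
    (hγ' : List.Forall₂ (fun a b => a.1 = b.1 ∧
      ExactIn VisibleToCircuit a.2.data a.2.stage a.2.dom b.2) Θ γ')
    (hδ : bulletEnv π γ = some δ)
    (hsim : ∀ x ∉ seen, ∀ v v', Assoc.find δ x = some v → Assoc.find γ' x = some v' → Sim v v') :
    EnvRel (accessRel π seen Θ) γ γ' := by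
  induction hγ generalizing seen δ γ' with
  | nil => cases hγ'; exact .nil
  | @cons a b Θ γ hab _ ih =>
    obtain ⟨x, q⟩ := a
    obtain ⟨y, w⟩ := b
    obtain ⟨⟨rfl : x = y⟩, hw⟩ := hab
    cases hγ' with | @cons _ b' _ γ' hab' hγ' =>
    obtain ⟨y, v'⟩ := b'
    obtain ⟨⟨rfl : x = y⟩, hv'⟩ := hab'
    obtain ⟨v, hv, δ, hδtail, rfl⟩ : ∃ v, bullet π w.1 w.2 = some v ∧ ∃ δ₁,
        bulletEnv π γ = some δ₁ ∧ (x, v) :: δ₁ = δ := by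
      simpa [bulletEnv, Option.bind_eq_some_iff] using hδ
    refine .cons ?_ (ih hγ' hδtail fun z hz u u' hu hu' => ?_)
    · split_ifs with hx
      · exact Option.isSome_of_mem hv
      · exact ⟨hw, hv', v, hv, hsim x hx v v' (by simp [Assoc.find]) (by simp [Assoc.find])⟩
    · rw [List.mem_cons, not_or] at hz
      refine hsim z hz.2 u u' ?_ ?_ <;> simpa only [Assoc.find, if_neg (Ne.symm hz.1)]

end AccessRel

theorem EnvRel.exists_bulletEnv {Δ : Assoc (Comp → MVal → Prop)} {γ : CEnv} {γ' : Env}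
    (h : EnvRel Δ γ γ')
    (hΔ : ∀ x R, (x, R) ∈ Δ → ∀ w v', R w v' → (bullet π w.1 w.2).isSome) :
    ∃ δ, bulletEnv π γ = some δ ∧ δ.map Prod.fst = γ'.map Prod.fst ∧
      ∀ x v v', Assoc.find δ x = some v → Assoc.find γ' x = some v' →
        ∃ R w, Assoc.find Δ x = some R ∧ R w v' ∧ bullet π w.1 w.2 = some v := by
  induction h with
  | nil => exact ⟨[], rfl, rfl, fun x v v' hv => by cases hv⟩
  | @cons y R w v' Δ γ γ' hwv _ ih =>
    obtain ⟨v, hv⟩ := Option.isSome_iff_exists.1 (hΔ y R List.mem_cons_self w v' hwv)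
    obtain ⟨δ, hδ, hvars, hfind⟩ := ih fun x R hR => hΔ x R (List.mem_cons_of_mem _ hR)
    refine ⟨(y, v) :: δ, by simp [bulletEnv, hv, hδ], by simp [hvars], fun x u u' hu hu' => ?_⟩
    simp only [Assoc.find] at hu hu' ⊢
    split_ifs at hu hu' ⊢ with hyx
    · cases hu; cases hu'
      exact ⟨R, w, rfl, hwv, hv⟩
    · exact hfind x u u' hu hu'

theorem EnvRel.cEnvSim {Θ : Assoc QType} {γ : CEnv} {γ' : Env}
    (h : EnvRel (accessRel π [] Θ) γ γ') : CEnvSim γ π γ' := by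
  obtain ⟨δ, hδ, hvars, hfind⟩ :=
    h.exists_bulletEnv fun x R hR w v' => isSome_bullet_of_mem_accessRel hR
  refine ⟨δ, hδ, hvars, fun x v v' hv hv' => ?_⟩
  obtain ⟨R, w, hR, hwv, hw⟩ := hfind x v v' hv hv'
  rw [find_accessRel List.not_mem_nil, Option.map_eq_some_iff] at hR
  obtain ⟨q, -, rfl⟩ := hR
  obtain ⟨-, -, u, hu, hsim⟩ := hwv
  exact Option.some.inj (hu.symm.trans hw) ▸ hsim

/-! ## Simulation -/

/-- The streams `ω₁` are what remains of the streams `ω` after the input nodes counted between `ν`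
and `ν₁` have been served. -/
def Consumes (ν ν₁ : Counter) (ω ω₁ : Streams) : Prop :=
  ∀ p, ν p ≤ ν₁ p ∧ ω₁ p = (ω p).drop (ν₁ p - ν p)

section Streams

variable {ν ν₁ ν₂ : Counter} {ω ω₁ ω₂ : Streams} {ι : List InputNode} {p : Party}

theorem Consumes.refl (ν : Counter) (ω : Streams) : Consumes ν ν ω ω := fun p => by simp

theorem Consumes.trans (h₁ : Consumes ν ν₁ ω ω₁) (h₂ : Consumes ν₁ ν₂ ω₁ ω₂) :
    Consumes ν ν₂ ω ω₂ := by
  intro p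
  obtain ⟨hν₁, hω₁⟩ := h₁ p
  obtain ⟨hν₂, hω₂⟩ := h₂ p
  refine ⟨hν₁.trans hν₂, ?_⟩
  rw [hω₂, hω₁, List.drop_drop, add_comm, Nat.sub_add_sub_cancel hν₂ hν₁]

theorem Consumes.typeCorrectStreams (h : Consumes ν ν₁ ω ω₁) (hι : TypeCorrectStreams ι ν ω) :
    TypeCorrectStreams ι ν₁ ω₁ := by
  intro i hi v hle hv
  obtain ⟨hν, hω⟩ := h i.party
  refine hι i hi v (hν.trans hle) ?_
  rwa [hω, List.getElem?_drop, add_comm, Nat.sub_add_sub_cancel hle hν] at hv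

theorem consumes_tail (p : Party) (ν : Counter) (ω : Streams) :
    Consumes ν (fun p' => if some p = some p' then ν p' + 1 else ν p') ω
      (fun p' => if p' = p then (ω p').tail else ω p') := by
  intro p'
  by_cases hp : p' = p
  · simp [hp]
  · simp [hp, Ne.symm hp]

theorem StreamSim.consumes (h : StreamSim (bulletCounter ν π) ω) (hω : Consumes ν ν₁ ω ω₁) :
    StreamSim (bulletCounter ν₁ π) ω₁ := by
  intro p
  obtain ⟨hν, hω⟩ := hω p
  simpa only [bulletCounter, ← List.map_drop, List.drop_drop, Nat.add_sub_cancel' hν, ← hω]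
    using List.forall₂_drop (ν₁ p - ν p) (h p)

theorem StreamSim.length_le (h : StreamSim (bulletCounter ν π) ω) (hp : ω p = []) :
    (π p).length ≤ ν p := by
  have hdrop := h p
  rwa [hp, List.forall₂_nil_right_iff, bulletCounter, List.map_eq_nil_iff,
    List.drop_eq_nil_iff] at hdrop

theorem StreamSim.head (h : StreamSim (bulletCounter ν π) ω) {a : MVal} {l : List MVal}
    (hp : ω p = a :: l) : ∃ n, (π p)[ν p]? = some n ∧ Sim (.nat n) a := by
  obtain ⟨a', ha', hsim⟩ := forall₂_getElem? (h p).flip (i := 0) (by rw [hp]; rfl)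
  simp only [bulletCounter, List.getElem?_map, List.getElem?_drop, add_zero,
    Option.map_eq_some_iff] at ha'
  obtain ⟨n, hn, rfl⟩ := ha'
  exact ⟨n, hn, hsim⟩

end Streams

/-- The state `(γ, ν)` of the compiler and the state `(γ', ω)` of the circuit semantics are
related: the environments by the relations in `Δ`, and the streams by the input of the circuit. -/
structure StateRel (π : CircuitInput) (Δ : Assoc (Comp → MVal → Prop)) (γ : CEnv) (ν : Counter)
    (γ' : Env) (ω : Streams) : Prop where
  env : EnvRel Δ γ γ'
  streams : StreamSim (bulletCounter ν π) ω

/-- Outcomes of compilation, as in `CompileResult`, but with any type `A` of results. -/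
abbrev CompileOutcome (A : Type) := A × CEnv × List Circuit × Counter × List InputNode

/-- An outcome of compilation, started with the counter `ν`, simulates an outcome of the circuit
semantics, started with the type correct streams `ω`. In the case of success the final states are
related and the output circuits accept `π`, in the case of failure they do not, unless an input is
missing. -/
def Simulated {A B : Type} (π : CircuitInput) (R : A → B → Prop)
    (Δ : Assoc (Comp → MVal → Prop)) (ν : Counter) (ω : Streams) :
    CompileOutcome A → Option (B × Env × Streams) → Prop
  | (a, γ, o, ν₁, ι), some (b, γ', ω₁) => TypeCorrectStreams ι ν ω →
      R a b ∧ StateRel π Δ γ ν₁ γ' ω₁ ∧ Accepts o π ∧ Consumes ν ν₁ ω ω₁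
  | (_, _, o, _, ι), none => TypeCorrectStreams ι ν ω → InputsAvailable ι π → ¬ Accepts o π

section Simulated

variable {A A₂ B B₂ : Type} {R : A → B → Prop} {R₂ : A₂ → B₂ → Prop}
  {Δ Δ₂ : Assoc (Comp → MVal → Prop)} {γ γ₁ γ₂ : CEnv} {γ' : Env} {ν ν₁ ν₂ : Counter} {ω : Streams}
  {x : Var}

theorem StateRel.push {S : Comp → MVal → Prop} {w : Comp} {v' : MVal}
    (h : StateRel π Δ γ ν γ' ω) (x : Var) (hw : S w v') :
    StateRel π ((x, S) :: Δ) ((x, w) :: γ) ν ((x, v') :: γ') ω :=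
  ⟨.cons hw h.env, h.streams⟩

theorem StateRel.pop {S : Comp → MVal → Prop} (h : StateRel π ((x, S) :: Δ) γ ν γ' ω) :
    StateRel π Δ γ.tail ν γ'.tail ω :=
  ⟨h.env.tail, h.streams⟩

theorem StateRel.update {S : Comp → MVal → Prop} {w : Comp} {v' : MVal}
    (h : StateRel π Δ γ ν γ' ω) (hx : Assoc.find Δ x = some S) (hw : S w v') :
    StateRel π Δ (Assoc.update γ x w) ν (Assoc.update γ' x v') ω :=
  ⟨h.env.update hx hw, h.streams⟩

theorem Simulated.pure {a : A} {b : B} (hR : R a b) (h : StateRel π Δ γ ν γ' ω) :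
    Simulated π R Δ ν ω (a, γ, [], ν, []) (some (b, γ', ω)) :=
  fun _ => ⟨hR, h, by simp [Accepts], .refl ν ω⟩

theorem Simulated.bind {a₁ : A} {a₂ : A₂} {o₁ o₂ : List Circuit} {ι₁ ι₂ : List InputNode}
    {r' : Option (B × Env × Streams)} {f : B × Env × Streams → Option (B₂ × Env × Streams)}
    (h₁ : Simulated π R Δ ν ω (a₁, γ₁, o₁, ν₁, ι₁) r')
    (h₂ : ∀ b γ' ω', R a₁ b → StateRel π Δ γ₁ ν₁ γ' ω' →
      Simulated π R₂ Δ₂ ν₁ ω' (a₂, γ₂, o₂, ν₂, ι₂) (f (b, γ', ω'))) :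
    Simulated π R₂ Δ₂ ν ω (a₂, γ₂, o₁ ++ o₂, ν₂, ι₁ ++ ι₂) (r'.bind f) := by
  have restrict (hι : TypeCorrectStreams (ι₁ ++ ι₂) ν ω) :
      TypeCorrectStreams ι₁ ν ω ∧ TypeCorrectStreams ι₂ ν ω :=
    ⟨fun i hi => hι i (List.mem_append_left _ hi), fun i hi => hι i (List.mem_append_right _ hi)⟩
  have inputsAvailable_append : InputsAvailable (ι₁ ++ ι₂) π ↔
    InputsAvailable ι₁ π ∧ InputsAvailable ι₂ π := List.forall_mem_append
  have accepts_append : Accepts (o₁ ++ o₂) π ↔ Accepts o₁ π ∧ Accepts o₂ π :=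
    List.forall_mem_append
  rcases r' with _ | ⟨b, γ', ω'⟩
  · intro hι hav hacc
    exact h₁ (restrict hι).1 (inputsAvailable_append.1 hav).1 (accepts_append.1 hacc).1
  · rw [Option.bind_some]
    rcases hf : f (b, γ', ω') with _ | ⟨b₂, γ₂', ω₂'⟩
    · intro hι hav hacc
      obtain ⟨hR, hstate, -, hω⟩ := h₁ (restrict hι).1
      have h₂ := h₂ b γ' ω' hR hstate
      rw [hf] at h₂
      exact h₂ (hω.typeCorrectStreams (restrict hι).2) (inputsAvailable_append.1 hav).2
        (accepts_append.1 hacc).2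
    · intro hι
      obtain ⟨hR, hstate, ho, hω⟩ := h₁ (restrict hι).1
      have h₂ := h₂ b γ' ω' hR hstate
      rw [hf] at h₂
      obtain ⟨hR₂, hstate₂, ho₂, hω₂⟩ := h₂ (hω.typeCorrectStreams (restrict hι).2)
      exact ⟨hR₂, hstate₂, accepts_append.2 ⟨ho, ho₂⟩, hω.trans hω₂⟩

theorem Simulated.map {a₁ : A} {a₂ : A₂} {o₁ : List Circuit} {ι₁ : List InputNode}
    {r' : Option (B × Env × Streams)} {f : B × Env × Streams → Option (B₂ × Env × Streams)}
    (h₁ : Simulated π R Δ ν ω (a₁, γ₁, o₁, ν₁, ι₁) r')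
    (h₂ : ∀ b γ' ω', R a₁ b → StateRel π Δ γ₁ ν₁ γ' ω' →
      Simulated π R₂ Δ₂ ν₁ ω' (a₂, γ₂, [], ν₂, []) (f (b, γ', ω'))) :
    Simulated π R₂ Δ₂ ν ω (a₂, γ₂, o₁, ν₂, ι₁) (r'.bind f) := by
  simpa only [List.append_nil] using h₁.bind h₂

theorem simulated_assertNode {m : Option ℕ+} {d : Domain} {w : Comp} {c : Circuit} {v' : MVal}
    (hv : ValRel π ⟨.bool m, .post, d⟩ w v') (hc : w.2 = some c)
    (h : StateRel π Δ γ ν γ' ω) :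
    Simulated π (ValRel π ⟨.unit, .pre, .pub⟩) Δ ν ω ((.unit, none), γ, [c], ν, [])
      (match (generalizing := false) v' with
        | .bool false => none
        | _ => some (.unit, γ', ω)) := by
  obtain ⟨b, rfl, hcb⟩ : ∃ b, v' = .bool b ∧ c.value π = some (code b) := by
    cases hv.scalarRel trivial with
    | constant henc hconst => cases henc; cases hc; exact ⟨_, rfl, hconst.value π⟩
    | secret _ henc hvalue => cases henc; cases hc; exact ⟨_, rfl, hvalue⟩
  cases b with
  | true => exact fun _ => ⟨valRel_unit π, h, by simp [Accepts, hcb, code], .refl ν ω⟩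
  | false => exact fun _ _ => by simp [Accepts, hcb, code]

theorem simulated_inputNode {t : DataType} (ht : t.IsScalar) {d : Domain} {p : Party}
    (hd : d.party = some p) (h : StateRel π Δ γ ν γ' ω) :
    Simulated π (ValRel π ⟨t, .post, d⟩) Δ ν ω
      ((.top, some (.inp p (ν p))), γ, [],
        fun p' => if some p = some p' then ν p' + 1 else ν p', [⟨p, ν p, t⟩])
      ((ω p).head?.bind fun a =>
        some (a, γ', fun p' => if p' = p then (ω p').tail else ω p')) := by
  rcases hω : ω p with _ | ⟨a, l⟩
  · exact fun _ hav _ =>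
      (h.streams.length_le hω).not_gt (hav ⟨p, ν p, t⟩ (List.mem_singleton_self _))
  · intro hι
    obtain ⟨n, hn, hsim⟩ := h.streams.head hω
    have hprim : a.HasPrim t :=
      hι _ (List.mem_singleton_self _) a le_rfl (by simp [hω])
    obtain ⟨v, k, henc⟩ := exists_encodes_of_hasPrim ht hprim
    obtain rfl := henc.sim_iff.1 hsim
    have hdp : d ≠ .pub := fun hpub => by cases hd.symm.trans (Domain.party_eq_none_iff.2 hpub)
    exact ⟨(ScalarRel.secret (c := .inp p (ν p)) hdp henc hn).valRel ht,
      ⟨h.env, h.streams.consumes (consumes_tail p ν ω)⟩, by simp [Accepts], consumes_tail p ν ω⟩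

end Simulated

/-- The circuit semantics `S` of a construct is simulated by its compilation `C` in the type
environment `Γ`: from related states, related results are obtained. -/
def Implements {A B : Type} (π : CircuitInput) (Γ : TyEnv) (R : A → B → Prop)
    (C : CEnv → Counter → Option (CompileOutcome A))
    (S : Env → Streams → Option (B × Env × Streams)) : Prop :=
  ∀ ⦃Δ γ ν γ' ω r⦄, Models π Γ Δ → StateRel π Δ γ ν γ' ω → C γ ν = some r →
    Simulated π R Δ ν ω r (S γ' ω)

theorem Implements.loop {Γ : TyEnv} {x : Var} {R : Comp → MVal → Prop}
    {C : CEnv → Counter → Option CompileResult}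
    {S : Env → Streams → Option (MVal × Env × Streams)} {m : Option ℕ+}
    (hbody : Implements π (.typing x ⟨.uint m, .pre, .pub⟩ :: Γ) R C S) (n i : ℕ) :
    Implements π (.typing x ⟨.uint m, .pre, .pub⟩ :: Γ) (List.Forall₂ R) (compileLoop C x n i)
      (circuitLoop S x n i) := by
  intro Δ γ ν γ' ω r hΔ h hr
  induction n generalizing i γ γ' ν ω r with
  | zero =>
    cases hr
    exact .pure .nil h
  | succ n ih =>
    simp only [compileLoop, Option.bind_eq_bind, Option.bind_eq_some_iff, Option.some.injEq] at hr
    obtain ⟨⟨a, γ₁, o₁, ν₁, ι₁⟩, h₁, ⟨as, γ₂, o₂, ν₂, ι₂⟩, h₂, rfl⟩ := hr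
    have hx : Assoc.find Δ x = some (ValRel π ⟨.uint m, .pre, .pub⟩) :=
      hΔ x _ (by simp [TyEnv.lookupType])
    refine (hbody hΔ (h.update hx (valRel_nat m i)) h₁).bind fun b γ₁' ω₁ hb hstate₁ => ?_
    refine (ih (i + 1) hstate₁ h₂).map fun bs γ₂' ω₂ hbs hstate₂ => ?_
    exact .pure (.cons hb hbs) hstate₂

/-! ## Simulation of expressions -/

/-- The compilation of `e` simulates its circuit semantics, as an expression of type `q` in the type
environment `Γ`. -/
def Simulates (φ : Inputs) (π : CircuitInput) (Γ : TyEnv) (e : Expr) (q : QType) : Prop :=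
  Implements π Γ (ValRel π q) (compile φ e) (circuitSem φ e)

/-- The compilation of the indices of the L-value `l` simulates their circuit semantics, where the
indices lead from a value of type `q₀` to a component of type `q`. -/
def SimulatesPath (φ : Inputs) (π : CircuitInput) (Γ : TyEnv) (q₀ : QType) (l : Expr) (q : QType) :
    Prop :=
  Implements π Γ (fun is is' => PathRel π q₀ is is' q) (compileIndices φ l) (circuitIndices φ l)

section Expressions

variable {φ : Inputs} {Γ : TyEnv} {e e₁ e₂ e₃ l : Expr} {q q₀ q₁ q₂ : QType} {t : DataType}
  {s s' : Stage} {d d' : Domain} {m : Option ℕ+} {x : Var}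

theorem simulates_eps : Simulates φ π Γ .eps ⟨.unit, .pre, .pub⟩ := by
  intro Δ γ ν γ' ω r _ h hr
  simp only [compile, Option.some.injEq] at hr
  subst hr
  simp only [circuitSem]
  exact .pure (valRel_unit π) h

theorem simulates_natLit (n : ℕ) (m : Option ℕ+) (s : Stage) (d : Domain) :
    Simulates φ π Γ (.natLit n m s d) ⟨.uint m, s, d⟩ := by
  intro Δ γ ν γ' ω r _ h hr
  simp only [compile, Option.some.injEq] at hr
  subst hr
  simp only [circuitSem]
  exact .pure ((Encodes.nat m n).valRel_literal s d) h

theorem simulates_boolLit (b : Bool) (m : Option ℕ+) (s : Stage) (d : Domain) :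
    Simulates φ π Γ (.boolLit b m s d) ⟨.bool m, s, d⟩ := by
  intro Δ γ ν γ' ω r _ h hr
  simp only [compile, Option.some.injEq] at hr
  subst hr
  simp only [circuitSem]
  exact .pure ((Encodes.bool m b).valRel_literal s d) h

theorem simulates_var (hx : Γ.lookupType x = some q) : Simulates φ π Γ (.var x) q := by
  intro Δ γ ν γ' ω r hΔ h hr
  simp only [compile, Option.bind_eq_bind, Option.bind_eq_some_iff, Option.some.injEq] at hr
  obtain ⟨w, hw, rfl⟩ := hr
  obtain ⟨v', hv', hwv⟩ := h.env.find (hΔ x q hx) hw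
  simp only [circuitSem, hv', Option.bind_eq_bind, Option.bind_some]
  exact .pure hwv h

theorem Simulates.add (hm : m = none → s = .pre) (h₁ : Simulates φ π Γ e₁ ⟨.uint m, s, d⟩)
    (h₂ : Simulates φ π Γ e₂ ⟨.uint m, s, d⟩) :
    Simulates φ π Γ (.add m e₁ e₂) ⟨.uint m, s, d⟩ := by
  intro Δ γ ν γ' ω r hΔ h hr
  simp only [compile, Option.bind_eq_bind, Option.bind_eq_some_iff, Option.some.injEq] at hr
  obtain ⟨⟨⟨v₁, c₁⟩, γ₁, o₁, ν₁, ι₁⟩, hr₁, ⟨⟨v₂, c₂⟩, γ₂, o₂, ν₂, ι₂⟩, hr₂, v, hv, rfl⟩ := hr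
  simp only [circuitSem, Option.bind_eq_bind]
  refine (h₁ hΔ h hr₁).bind fun v₁' γ₁' ω₁ hv₁ hstate₁ => ?_
  refine (h₂ hΔ hstate₁ hr₂).map fun v₂' γ₂' ω₂ hv₂ hstate₂ => ?_
  obtain ⟨v', hv', hrel⟩ := hv₁.add hm hv₂ hv
  simp only [hv', Option.bind_some]
  exact .pure hrel hstate₂

theorem Simulates.assertion (h₁ : Simulates φ π Γ e ⟨.bool m, .post, d⟩) :
    Simulates φ π Γ (.assertion e) ⟨.unit, .pre, .pub⟩ := by
  intro Δ γ ν γ' ω r hΔ h hr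
  simp only [compile, Option.bind_eq_bind, Option.bind_eq_some_iff, Option.some.injEq] at hr
  obtain ⟨⟨⟨v₁, c₁⟩, γ₁, o₁, ν₁, ι₁⟩, hr₁, c, rfl, rfl⟩ := hr
  simp only [circuitSem, Option.bind_eq_bind]
  rw [← List.append_nil ι₁]
  exact (h₁ hΔ h hr₁).bind fun v' γ₁' ω₁ hv hstate => simulated_assertNode hv rfl hstate

theorem simulates_get {k : Key} (ht : allPre d' t s d)
    (hφ : ExactIn (fun q => q.dom ≤ d') t s d (φ d' k).allPure) :
    Simulates φ π Γ (.get d' k ⟨t, s, d⟩) ⟨t, s, d⟩ := by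
  intro Δ γ ν γ' ω r _ h hr
  simp only [compile, Option.some.injEq] at hr
  subst hr
  simp only [circuitSem]
  by_cases hd : d' = .pub
  · subst hd
    simpa only [if_true] using .pure (valRel_allPure ht hφ) h
  · obtain ⟨rfl, rfl⟩ := eq_of_allPre ht
    simpa only [hd, if_false] using .pure (valRel_top t hd) h

theorem Simulates.cond (h₁ : Simulates φ π Γ e₁ ⟨.bool m, .pre, d'⟩)
    (h₂ : Simulates φ π Γ e₂ ⟨t, s, d⟩) (h₃ : Simulates φ π Γ e₃ ⟨t, s, d⟩)
    (hd : s.up ∪ d.up ⊆ d'.up) : Simulates φ π Γ (.cond e₁ e₂ e₃) ⟨t, s, d⟩ := by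
  intro Δ γ ν γ' ω r hΔ h hr
  simp only [compile, Option.bind_eq_bind, Option.bind_eq_some_iff] at hr
  obtain ⟨⟨⟨v₁, c₁⟩, γ₁, o₁, ν₁, ι₁⟩, hr₁, hr⟩ := hr
  simp only [circuitSem, Option.bind_eq_bind]
  have guard := h₁ hΔ h hr₁
  split at hr
  case h_1 hv₁ =>
    subst hv₁
    simp only [Option.bind_eq_some_iff, Option.some.injEq] at hr
    obtain ⟨⟨w, γ₂, o₂, ν₂, ι₂⟩, hr₂, rfl⟩ := hr
    refine guard.bind fun v₁' γ₁' ω₁ hv hstate => ?_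
    cases hv.scalarRel trivial with
    | known henc => cases henc; exact h₂ hΔ hstate hr₂
  case h_2 hv₁ =>
    subst hv₁
    simp only [Option.bind_eq_some_iff, Option.some.injEq] at hr
    obtain ⟨⟨w, γ₃, o₃, ν₃, ι₃⟩, hr₃, rfl⟩ := hr
    refine guard.bind fun v₁' γ₁' ω₁ hv hstate => ?_
    cases hv.scalarRel trivial with
    | known henc => cases henc; exact h₃ hΔ hstate hr₃
  case h_3 hv_true hv_false =>
    cases hr
    refine guard.map fun v₁' γ₁' ω₁ hv hstate => ?_
    cases hv.scalarRel trivial with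
    | hidden hd' =>
      obtain ⟨rfl, hd₁⟩ := hidden_of_up_subset hd hd'
      exact .pure (valRel_top t hd₁) hstate
    | known henc =>
      cases henc with
      | bool _ b => cases b; exacts [absurd rfl hv_false, absurd rfl hv_true]

theorem Simulates.loop (h₁ : Simulates φ π Γ e₁ ⟨.uint m, .pre, d'⟩)
    (h₂ : Simulates φ π Γ e₂ ⟨.uint m, .pre, d'⟩)
    (h₃ : Simulates φ π (.typing x ⟨.uint m, .pre, d'⟩ :: Γ) e₃ ⟨t, s, d⟩) :
    Simulates φ π Γ (.loop x e₁ e₂ e₃) ⟨.list t s d, .pre, d'⟩ := by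
  intro Δ γ ν γ' ω r hΔ h hr
  simp only [compile, Option.bind_eq_bind, Option.bind_eq_some_iff] at hr
  obtain ⟨⟨⟨v₁, c₁⟩, γ₁, o₁, ν₁, ι₁⟩, hr₁, ⟨⟨v₂, c₂⟩, γ₂, o₂, ν₂, ι₂⟩, hr₂, hr⟩ := hr
  simp only [circuitSem, Option.bind_eq_bind]
  have lower := h₁ hΔ h hr₁
  by_cases hv : ∃ i₁ i₂, v₁ = .nat i₁ ∧ v₂ = .nat i₂
  · obtain ⟨i₁, i₂, rfl, rfl⟩ := hv
    simp only [Option.bind_eq_some_iff, Option.some.injEq] at hr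
    obtain ⟨⟨as, γ₃, o₃, ν₃, ι₃⟩, hr₃, rfl⟩ := hr
    rw [List.append_assoc, List.append_assoc]
    refine lower.bind fun v₁' γ₁' ω₁ hv₁ hstate₁ => ?_
    obtain ⟨rfl, rfl⟩ : d' = .pub ∧ v₁' = .nat i₁ := by
      cases hv₁.scalarRel trivial with | known henc => cases henc; exact ⟨rfl, rfl⟩
    refine (h₂ hΔ hstate₁ hr₂).bind fun v₂' γ₂' ω₂ hv₂ hstate₂ => ?_
    obtain ⟨_, ⟨⟩, rfl⟩ := hv₂.exists_eq_nat
    have iterations := Implements.loop h₃ (i₂ - i₁) i₁ (hΔ.cons x _)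
      (hstate₂.push x (valRel_nat m i₁)) hr₃
    refine iterations.map fun as' γ₃' ω₃ has hstate₃ => ?_
    exact .pure (valRel_list_iff.2 ⟨_, _, rfl, rfl, has⟩) hstate₃.pop
  · have hr : r = ((.top, none), γ₂, o₁ ++ o₂, ν₂, ι₁ ++ ι₂) := by
      cases v₁ <;> cases v₂ <;> simp_all
    subst hr
    refine lower.bind fun v₁' γ₁' ω₁ hv₁ hstate₁ => ?_
    refine (h₂ hΔ hstate₁ hr₂).map fun v₂' γ₂' ω₂ hv₂ hstate₂ => ?_
    by_cases hd' : d' = .pub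
    · subst hd'
      obtain ⟨i₁, ⟨⟩, -⟩ := hv₁.exists_eq_nat
      obtain ⟨i₂, ⟨⟩, -⟩ := hv₂.exists_eq_nat
      exact absurd ⟨i₁, i₂, rfl, rfl⟩ hv
    · obtain ⟨-, rfl⟩ := (valRel_hidden_iff hd').1 hv₁
      exact .pure (valRel_top _ hd') hstate₂

theorem Simulates.wire (ht : t.IsScalar) (h₁ : Simulates φ π Γ e ⟨t, .pre, d⟩) :
    Simulates φ π Γ (.wire t d e) ⟨t, .post, d⟩ := by
  intro Δ γ ν γ' ω r hΔ h hr
  simp only [compile, Option.bind_eq_bind, Option.bind_eq_some_iff] at hr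
  obtain ⟨⟨⟨v₁, c₁⟩, γ₁, o₁, ν₁, ι₁⟩, hr₁, hr⟩ := hr
  simp only [circuitSem, Option.bind_eq_bind]
  have argument := h₁ hΔ h hr₁
  cases v₁ with
  | nat n | bool b =>
    cases hr
    refine argument.map fun v' γ₁' ω₁ hv hstate => ?_
    cases hv.scalarRel ht with
    | known henc =>
      cases henc
      exact .pure ((ScalarRel.constant (by constructor) (constCircuit_con _)).valRel ht) hstate
  | top =>
    obtain ⟨p, hp, hr⟩ := Option.bind_eq_some_iff.1 hr
    cases hr
    rw [← List.append_nil o₁]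
    simp only [hp]
    exact argument.bind fun v' γ₁' ω₁ _ hstate => simulated_inputNode ht hp hstate
  | unit | list => cases hr

theorem Simulates.cast (h₁ : Simulates φ π Γ e ⟨t, s, d⟩) (ht : WellStructured t s d)
    (hs : s ≤ s') (hd : d ≤ d') : Simulates φ π Γ (.cast e ⟨t, s', d'⟩) ⟨t, s', d'⟩ := by
  intro Δ γ ν γ' ω r hΔ h hr
  simp only [compile, Option.bind_eq_bind, Option.bind_eq_some_iff, Option.some.injEq] at hr
  obtain ⟨⟨⟨v₁, c₁⟩, γ₁, o₁, ν₁, ι₁⟩, hr₁, rfl⟩ := hr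
  simp only [circuitSem, Option.bind_eq_bind]
  exact (h₁ hΔ h hr₁).map fun v' γ₁' ω₁ hv hstate => .pure (hv.cast ht hs hd) hstate

theorem Simulates.assign (hl : l.root = some x) (hx : Γ.lookupType x = some q₀)
    (hq₀ : WellStructured q₀.data q₀.stage q₀.dom) (h₁ : SimulatesPath φ π Γ q₀ l q)
    (h₂ : Simulates φ π Γ e q) : Simulates φ π Γ (.assign l e) ⟨.unit, .pre, .pub⟩ := by
  intro Δ γ ν γ' ω r hΔ h hr
  simp only [compile, hl, Option.bind_eq_bind, Option.bind_some, Option.bind_eq_some_iff,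
    Option.some.injEq] at hr
  obtain ⟨a, ha, ⟨is, γ₁, o₁, ν₁, ι₁⟩, hr₁, ⟨w, γ₂, o₂, ν₂, ι₂⟩, hr₂, b, hb, rfl⟩ := hr
  have hxΔ := hΔ x q₀ hx
  obtain ⟨a', ha', haa⟩ := h.env.find hxΔ ha
  simp only [circuitSem, hl, ha', Option.bind_eq_bind, Option.bind_some]
  refine (h₁ hΔ h hr₁).bind fun is' γ₁' ω₁ his hstate₁ => ?_
  refine (h₂ hΔ hstate₁ hr₂).map fun w' γ₂' ω₂ hw hstate₂ => ?_
  obtain ⟨b', hb', hbb⟩ := his.upd hq₀ haa hw hb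
  simp only [hb', Option.bind_some]
  exact .pure (valRel_unit π) (hstate₂.update hxΔ hbb)

theorem Simulates.load (h₁ : Simulates φ π Γ l ⟨.list t s d, s', d'⟩)
    (h₂ : Simulates φ π Γ e ⟨.uint m, s', d'⟩) (ht : WellStructured (.list t s d) s' d') :
    Simulates φ π Γ (.load l e) ⟨t, s, d⟩ := by
  intro Δ γ ν γ' ω r hΔ h hr
  simp only [compile, Option.bind_eq_bind, Option.bind_eq_some_iff, Option.some.injEq] at hr
  obtain ⟨⟨⟨a, c₁⟩, γ₁, o₁, ν₁, ι₁⟩, hr₁, ⟨⟨i, c₂⟩, γ₂, o₂, ν₂, ι₂⟩, hr₂, w, hw, rfl⟩ := hr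
  simp only [circuitSem, Option.bind_eq_bind]
  refine (h₁ hΔ h hr₁).bind fun a' γ₁' ω₁ ha hstate₁ => ?_
  refine (h₂ hΔ hstate₁ hr₂).map fun i' γ₂' ω₂ hi hstate₂ => ?_
  obtain ⟨w', hw', hrel⟩ := ha.index ht hi hw
  simp only [hw', Option.bind_some]
  exact .pure hrel hstate₂

theorem Simulates.letIn {b : Bool} (h₁ : Simulates φ π Γ e₁ q₁)
    (h₂ : Simulates φ π (.mutability x b :: .typing x q₁ :: Γ) e₂ q₂) :
    Simulates φ π Γ (.letIn b x e₁ e₂) q₂ := by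
  intro Δ γ ν γ' ω r hΔ h hr
  simp only [compile, Option.bind_eq_bind, Option.bind_eq_some_iff, Option.some.injEq] at hr
  obtain ⟨⟨w₁, γ₁, o₁, ν₁, ι₁⟩, hr₁, ⟨w₂, γ₂, o₂, ν₂, ι₂⟩, hr₂, rfl⟩ := hr
  simp only [circuitSem, Option.bind_eq_bind]
  refine (h₁ hΔ h hr₁).bind fun v₁ γ₁' ω₁ hv₁ hstate₁ => ?_
  refine (h₂ (hΔ.cons x q₁) (hstate₁.push x hv₁) hr₂).map fun v₂ γ₂' ω₂ hv₂ hstate₂ => ?_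
  exact .pure hv₂ hstate₂.pop

theorem Simulates.seq (h₁ : Simulates φ π Γ e₁ q₁) (h₂ : Simulates φ π Γ e₂ q₂) :
    Simulates φ π Γ (.seq e₁ e₂) q₂ := by
  intro Δ γ ν γ' ω r hΔ h hr
  simp only [compile, Option.bind_eq_bind, Option.bind_eq_some_iff, Option.some.injEq] at hr
  obtain ⟨⟨w₁, γ₁, o₁, ν₁, ι₁⟩, hr₁, ⟨w₂, γ₂, o₂, ν₂, ι₂⟩, hr₂, rfl⟩ := hr
  simp only [circuitSem, Option.bind_eq_bind]
  exact (h₁ hΔ h hr₁).bind fun v₁ γ₁' ω₁ _ hstate => h₂ hΔ hstate hr₂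

theorem simulatesPath_var (x : Var) (q : QType) : SimulatesPath φ π Γ q (.var x) q := by
  intro Δ γ ν γ' ω r _ h hr
  simp only [compileIndices, Option.some.injEq] at hr
  subst hr
  simp only [circuitIndices]
  exact .pure .nil h

theorem SimulatesPath.load (h₁ : SimulatesPath φ π Γ q₀ l ⟨.list t s d, s', d'⟩)
    (h₂ : Simulates φ π Γ e ⟨.uint none, s', d'⟩) :
    SimulatesPath φ π Γ q₀ (.load l e) ⟨t, s, d⟩ := by
  intro Δ γ ν γ' ω r hΔ h hr
  simp only [compileIndices, Option.bind_eq_bind, Option.bind_eq_some_iff, Option.some.injEq] at hr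
  obtain ⟨⟨is, γ₁, o₁, ν₁, ι₁⟩, hr₁, ⟨⟨i, c⟩, γ₂, o₂, ν₂, ι₂⟩, hr₂, rfl⟩ := hr
  simp only [circuitIndices, Option.bind_eq_bind]
  refine (h₁ hΔ h hr₁).bind fun is' γ₁' ω₁ his hstate₁ => ?_
  refine (h₂ hΔ hstate₁ hr₂).map fun i' γ₂' ω₂ hi hstate₂ => ?_
  exact .pure (his.concat hi) hstate₂

theorem TypeCorrectInputs.mono (hφ : TypeCorrectInputs φ e)
    (he : e₁.gets ⊆ e.gets := by simp [Expr.gets]) : TypeCorrectInputs φ e₁ :=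
  fun d k q h => hφ d k q (he h)

theorem HasType.simulates {D : Set Domain} (he : HasType Γ e q D) (hΓ : Γ.WellStructured)
    (hφ : TypeCorrectInputs φ e) :
    Simulates φ π Γ e q ∧ ∀ x, e.root = some x →
      ∃ q₀, Γ.lookupType x = some q₀ ∧ SimulatesPath φ π Γ q₀ e q := by
  induction he with
  | eps => exact ⟨simulates_eps, nofun⟩
  | natLit => exact ⟨simulates_natLit _ _ _ _, nofun⟩
  | boolLit => exact ⟨simulates_boolLit _ _ _ _, nofun⟩
  | @var _ x q hx =>
    refine ⟨simulates_var hx, fun y hy => ?_⟩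
    cases hy
    exact ⟨q, hx, simulatesPath_var x q⟩
  | add hm _ _ ih₁ ih₂ => exact ⟨.add hm (ih₁ hΓ hφ.mono).1 (ih₂ hΓ hφ.mono).1, nofun⟩
  | assertion _ ih => exact ⟨.assertion (ih hΓ hφ).1, nofun⟩
  | get ht => exact ⟨simulates_get ht (hφ _ _ _ (List.mem_singleton_self _)), nofun⟩
  | cond _ _ _ hd ih₁ ih₂ ih₃ =>
    have hd := (Set.subset_union_left.trans Set.subset_union_left).trans hd
    exact ⟨.cond (ih₁ hΓ hφ.mono).1 (ih₂ hΓ hφ.mono).1 (ih₃ hΓ hφ.mono).1 hd, nofun⟩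
  | loop _ _ _ _ ih₁ ih₂ ih₃ =>
    have body := (ih₃ (hΓ.cons_typing _ trivial) hφ.mono).1
    exact ⟨.loop (ih₁ hΓ hφ.mono).1 (ih₂ hΓ hφ.mono).1 body, nofun⟩
  | wire ht _ ih => exact ⟨.wire (by rcases ht with rfl | rfl <;> trivial) (ih hΓ hφ).1, nofun⟩
  | cast he hs hd _ ih => exact ⟨.cast (ih hΓ hφ).1 (he.wellStructured hΓ) hs hd, nofun⟩
  | assign _ _ hl _ ih ihl =>
    obtain ⟨q₀, hq₀, path⟩ := (ihl hΓ hφ.mono).2 _ hl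
    exact ⟨.assign hl hq₀ (hΓ.lookupType hq₀) path (ih hΓ hφ.mono).1, nofun⟩
  | load _ hl _ ihl ih =>
    have list := ihl hΓ hφ.mono
    have index := (ih hΓ hφ.mono).1
    refine ⟨list.1.load index (hl.wellStructured hΓ), fun x hx => ?_⟩
    obtain ⟨q₀, hq₀, path⟩ := list.2 x hx
    exact ⟨q₀, hq₀, path.load index⟩
  | letIn he₁ _ ih₁ ih₂ =>
    have body := (ih₂ (hΓ.cons_typing _ (he₁.wellStructured hΓ)) hφ.mono).1
    exact ⟨.letIn (ih₁ hΓ hφ.mono).1 body, nofun⟩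
  | seq _ _ ih₁ ih₂ => exact ⟨.seq (ih₁ hΓ hφ.mono).1 (ih₂ hΓ hφ.mono).1, nofun⟩

end Expressions

end ZKSC

theorem mainTheorem1
    (Γ : TyEnv) (e : Expr) (t : DataType) (s : Stage) (d : Domain) (D : Set Domain)
    (hΓ : TyEnv.WellStructured Γ) (he : HasType Γ e ⟨t, s, d⟩ D)
    (γ : CEnv) (hγ : CEnvExact Γ γ)
    (φ : Inputs) (hφ : TypeCorrectInputs φ e)
    (ν : Counter)
    (v : CVal) (c : Option Circuit) (γr : CEnv) (o : List Circuit) (νr : Counter)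
    (ι : List InputNode)
    (hcompile : compile φ e γ ν = some ((v, c), γr, o, νr, ι))
    (π : CircuitInput) (γ' : Env) (ω' : Streams)
    (hγ' : ExactInCircuit Γ γ')
    (hγγ' : CEnvSim γ π γ')
    (hω' : StreamSim (bulletCounter ν π) ω')
    (hωt : TypeCorrectStreams ι ν ω') :
    (∀ (v' : MVal) (γr' : Env) (ωr' : Streams),
      circuitSem φ e γ' ω' = some (v', γr', ωr') →
        Accepts o π ∧
        CEnvSim γr π γr' ∧
        StreamSim (bulletCounter νr π) ωr' ∧
        (d = Domain.pub ∨ s = Stage.post → CompSim (v, c) π v')) ∧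
    (circuitSem φ e γ' ω' = none → InputsAvailable ι π → ¬ Accepts o π) := by
  obtain ⟨δ, hδ, -, hsim⟩ := hγγ'
  have states : StateRel π (accessRel π [] Γ.typings) γ ν γ' ω' :=
    ⟨envRel_accessRel hγ hγ' hδ fun x _ => hsim x, hω'⟩
  have outcomes := (he.simulates hΓ hφ).1 (models_accessRel Γ) states hcompile
  constructor
  · intro v' γr' ωr' hrun
    rw [hrun] at outcomes
    obtain ⟨hv, ⟨henv, hstreams⟩, haccepts, -⟩ := outcomes hωt
    exact ⟨haccepts, henv.cEnvSim, hstreams, fun _ => hv.2.2⟩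
  · intro hfail
    rw [hfail] at outcomes
    exact outcomes hωt
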